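/- Let $d$ be a non-negative integer and let $p_X=\{p_X(k)\}$, $p_Y=\{p_Y(k)\}$ be probability mass functions on $\mathbb N^d\subset\mathbb R^d$. Let $X_1,X_2,\dots$ be i.i.d. with law $p_X$ and $Y_1,Y_2,\dots$ i.i.d. with law $p_Y$, the two samples being mutually independent. Let $r_1\ge 1$ and $r_2\ge 0$ be integers, $r=r_1+r_2$, $\mathbf r=(r_1,r_2)$. For sample sizes $\mathbf n=(n_1,n_2)$ put $n=n_1+n_2$, $p_{\mathbf n}=n_1/n$; $\mathbf n\to\infty$ means that $n_1,n_2\to\infty$ along a sequence of sample sizes, and it is assumed that then $p_{\mathbf n}\to p$ for some $0<p<1$. For integers $a\ge1$, $b\ge0$ put $q_{a,b}=\sum_{k}p_X(k)^{a}p_Y(k)^{b}$ and $$Q_{\mathbf n,a,b}=\binom{n_1}{a}^{-1}\binom{n_2}{b}^{-1}\sum_{S}\sum_{T}\psi(S;T),\qquad \psi(S;T)=\frac1{a}\sum_{i\in S}I\bigl(|X_i-X_j|\le\epsilon,\ |X_i-Y_k|\le\epsilon\ \ \forall j\in S,\ \forall k\in T\bigr)$$ with $\epsilon=0$ (exact coincidences),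 where $S$ runs over the $a$-subsets of $\{1,\dots,n_1\}$, $T$ over the $b$-subsets of $\{1,\dots,n_2\}$, and $|\cdot|$ is the Euclidean norm. Write $q_{\mathbf r}=q_{r_1,r_2}$ and $Q_{\mathbf n}=Q_{\mathbf n,r_1,r_2}$. With $X\sim p_X$ and $Y\sim p_Y$ let $$\zeta_{1,0}=\mathrm{Var}\bigl(p_X(X)^{r_1-1}p_Y(X)^{r_2}\bigr),\quad \zeta_{0,1}=\mathrm{Var}\bigl(p_X(Y)^{r_1}p_Y(Y)^{r_2-1}\bigr),\quad \kappa=p^{-1}r_1^2\zeta_{1,0}+(1-p)^{-1}r_2^2\zeta_{0,1},$$ $$K_{\mathbf n}=p_{\mathbf n}^{-1}r_1^2\bigl(Q_{\mathbf n,2r_1-1,2r_2}-Q_{\mathbf n}^2\bigr)+(1-p_{\mathbf n})^{-1}r_2^2\bigl(Q_{\mathbf n,2r_1,2r_2-1}-Q_{\mathbf n}^2\bigr),\quad k_{\mathbf n}=\max(K_{\mathbf n},1/n),$$ where for $r_2=0$ the terms with the factor $r_2^2$ are read as $0$. For $r\ne1$ let $$H_{\mathbf n}=\frac{\log(\max(Q_{\mathbf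 n},1/n))}{1-r},\qquad h_{\mathbf r}=\frac{\log q_{\mathbf r}}{1-r}.$$ Theorem. Assume $\zeta_{1,0}>0$ and, if $r_2\ge1$, also $\zeta_{0,1}>0$. (Then $r\neq 1$ and $q_{\mathbf r}>0$.) As $\mathbf n\to\infty$, in distribution, $$\sqrt n\,(Q_{\mathbf n}-q_{\mathbf r})\to N(0,\kappa),\qquad \frac{\sqrt n\,(Q_{\mathbf n}-q_{\mathbf r})}{k_{\mathbf n}^{1/2}}\to N(0,1),\qquad \sqrt n\,(1-r)\,\frac{Q_{\mathbf n}}{k_{\mathbf n}^{1/2}}\,(H_{\mathbf n}-h_{\mathbf r})\to N(0,1).$$ -/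

import Mathlib

open MeasureTheory ProbabilityTheory Filter Topology

noncomputable section

namespace RenyiCoincidence

/-- A point of `ℕ^d`, seen as a point of Euclidean space `ℝ^d`. -/
def toEuclid {d : ℕ} (k : Fin d → ℕ) : EuclideanSpace ℝ (Fin d) :=
  WithLp.toLp 2 (fun i => (k i : ℝ))

open Classical in
/-- `ψ^{(i)}(S;T)`: the indicator that all `x j`, `j ∈ S`, and all `y k`, `k ∈ T`, are within
distance `ε` of `x i`. -/
def psiAt {E : Type*} [PseudoMetricSpace E] (ε : ℝ) (x y : ℕ → E) (S T : Finset ℕ) (i : ℕ) : ℝ :=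
  if (∀ j ∈ S, dist (x i) (x j) ≤ ε) ∧ (∀ k ∈ T, dist (x i) (y k) ≤ ε) then 1 else 0

/-- The symmetrized kernel `ψ(S;T) = |S|⁻¹ ∑_{i ∈ S} ψ^{(i)}(S;T)` (here `|S| = r₁ ≥ 1`). -/
def psi {E : Type*} [PseudoMetricSpace E] (ε : ℝ) (x y : ℕ → E) (S T : Finset ℕ) : ℝ :=
  (S.card : ℝ)⁻¹ * ∑ i ∈ S, psiAt ε x y S T i

/-- The generalized `U`-statistic `Q_{n,r,ε}` with `n = (n₁,n₂)`, `r = (r₁,r₂)`, evaluated at the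
samples `x 0, …, x (n₁-1)` and `y 0, …, y (n₂-1)`. -/
def uStat {E : Type*} [PseudoMetricSpace E] (ε : ℝ) (n₁ n₂ r₁ r₂ : ℕ) (x y : ℕ → E) : ℝ :=
  (n₁.choose r₁ : ℝ)⁻¹ * (n₂.choose r₂ : ℝ)⁻¹ *
    ∑ S ∈ (Finset.range n₁).powersetCard r₁, ∑ T ∈ (Finset.range n₂).powersetCard r₂,
      psi ε x y S T

/-- The estimator `Q_{n,r} = Q_{n,r,0}` for samples with values in `ℕ^d ⊆ ℝ^d`. -/
def Q {d : ℕ} (n₁ n₂ r₁ r₂ : ℕ) (x y : ℕ → (Fin d → ℕ)) : ℝ :=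
  uStat 0 n₁ n₂ r₁ r₂ (fun i => toEuclid (x i)) (fun i => toEuclid (y i))

/-- The functional `q_r = ∑_k p_X(k)^{r₁} p_Y(k)^{r₂}`. -/
def q {d : ℕ} (pX pY : PMF (Fin d → ℕ)) (r₁ r₂ : ℕ) : ℝ :=
  ∑' k, (pX k).toReal ^ r₁ * (pY k).toReal ^ r₂

/-- `ζ_{1,0} = Var(p_X(X)^{r₁-1} p_Y(X)^{r₂})`, where `X` has law `pX`; used for `1 ≤ r₁`. -/
def zeta10 {d : ℕ} (pX pY : PMF (Fin d → ℕ)) (r₁ r₂ : ℕ) : ℝ :=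
  Var[fun k => (pX k).toReal ^ (r₁ - 1) * (pY k).toReal ^ r₂; pX.toMeasure]

/-- `ζ_{0,1} = Var(p_X(Y)^{r₁} p_Y(Y)^{r₂-1})`, where `Y` has law `pY`. It is only relevant for
`1 ≤ r₂`: for `r₂ = 0` it is multiplied by `r₂ ^ 2 = 0` wherever it is used. -/
def zeta01 {d : ℕ} (pX pY : PMF (Fin d → ℕ)) (r₁ r₂ : ℕ) : ℝ :=
  Var[fun k => (pX k).toReal ^ r₁ * (pY k).toReal ^ (r₂ - 1); pY.toMeasure]

/-- The asymptotic variance `κ = p⁻¹ r₁² ζ_{1,0} + (1-p)⁻¹ r₂² ζ_{0,1}`. -/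
def kappa {d : ℕ} (pX pY : PMF (Fin d → ℕ)) (p : ℝ) (r₁ r₂ : ℕ) : ℝ :=
  p⁻¹ * (r₁ : ℝ) ^ 2 * zeta10 pX pY r₁ r₂ + (1 - p)⁻¹ * (r₂ : ℝ) ^ 2 * zeta01 pX pY r₁ r₂

/-- The proportion `p_n = n₁ / n` with `n = n₁ + n₂`. -/
def prop (n₁ n₂ : ℕ) : ℝ := (n₁ : ℝ) / ((n₁ : ℝ) + (n₂ : ℝ))

/-- The plug-in estimator `K_n` of `κ`. For `r₂ = 0` the second summand vanishes. -/
def K {d : ℕ} (n₁ n₂ r₁ r₂ : ℕ) (x y : ℕ → (Fin d → ℕ)) : ℝ :=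
  (prop n₁ n₂)⁻¹ * (r₁ : ℝ) ^ 2 *
      (Q n₁ n₂ (2 * r₁ - 1) (2 * r₂) x y - Q n₁ n₂ r₁ r₂ x y ^ 2) +
    (1 - prop n₁ n₂)⁻¹ * (r₂ : ℝ) ^ 2 *
      (Q n₁ n₂ (2 * r₁) (2 * r₂ - 1) x y - Q n₁ n₂ r₁ r₂ x y ^ 2)

/-- The truncated estimator `k_n = max(K_n, 1/n)`. -/
def kTrunc {d : ℕ} (n₁ n₂ r₁ r₂ : ℕ) (x y : ℕ → (Fin d → ℕ)) : ℝ :=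
  max (K n₁ n₂ r₁ r₂ x y) (1 / ((n₁ : ℝ) + (n₂ : ℝ)))

/-- The entropy estimator `H_n = log(max(Q_n, 1/n)) / (1-r)`, `r = r₁ + r₂`. -/
def H {d : ℕ} (n₁ n₂ r₁ r₂ : ℕ) (x y : ℕ → (Fin d → ℕ)) : ℝ :=
  Real.log (max (Q n₁ n₂ r₁ r₂ x y) (1 / ((n₁ : ℝ) + (n₂ : ℝ)))) /
    (1 - ((r₁ : ℝ) + (r₂ : ℝ)))

/-- The entropy `h_r = log(q_r) / (1-r)`, `r = r₁ + r₂`. -/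
def h {d : ℕ} (pX pY : PMF (Fin d → ℕ)) (r₁ r₂ : ℕ) : ℝ :=
  Real.log (q pX pY r₁ r₂) / (1 - ((r₁ : ℝ) + (r₂ : ℝ)))

end RenyiCoincidence

end

/-!
The kernel at radius `0` is the indicator that all sampled points coincide, so `Q` depends on the
samples only through the counts of each atom (`Q_eq_tsum`) and differs by a nonrandom `O(1/n)` from
the plug-in functional `∑ k, u k ^ a * v k ^ b` of the empirical frequencies `u`, `v` of the two
samples (`abs_Q_sub_plugin_le`). This avoids the Hoeffding decomposition: the functional is a
polynomial in each coordinate, so a Taylor expansion at `(p_X, p_Y)` leaves a remainder at most a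
constant times the squared `ℓ²` distances of the empirical laws to the true ones
(`abs_tsum_monomial_sub_taylor_le`). These have expectation at most `1/n₁` and `1/n₂`
(`lintegral_tsum_empFreq_sub_sq_le`), and the remainder is negligible at the scale `√n`
(`tendstoInMeasure_remainder`).

The linear part is a sum of two independent centred sample means of bounded functions; the central
limit theorem for each, combined through characteristic functions, gives the limit `N(0, κ)`
(`tendstoInDistribution_sqrt_mul_Q_sub`).

For the studentized statements, the empirical laws converge almost surely in `ℓ¹`
(`ae_tendsto_tsum_abs_empFreq_sub`), so every `Q_{a,b}` is strongly consistent, and so is `k_n`,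
because `ζ_{1,0}` and `ζ_{0,1}` are polynomials in the functionals `q_{a,b}`. Slutsky's theorem then
gives the second limit. The third is the delta method for the logarithm, the difference quotient
being the continuous function `dslope Real.log q`.
-/

namespace RenyiCoincidence

/-! ### Elementary inequalities for powers and binomial ratios -/

lemma abs_pow_sub_pow_le {u s : ℝ} (hu : u ∈ Set.Icc (0 : ℝ) 1) (hs : s ∈ Set.Icc (0 : ℝ) 1)
    (a : ℕ) : |u ^ a - s ^ a| ≤ a * |u - s| := by
  induction a with
  | zero => simp
  | succ a ih =>
    have e : u ^ (a + 1) - s ^ (a + 1) = (u ^ a - s ^ a) * u + s ^ a * (u - s) := by ring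
    have h1 : |(u ^ a - s ^ a) * u| ≤ a * |u - s| := by
      rw [abs_mul, abs_of_nonneg hu.1]
      exact (mul_le_of_le_one_right (abs_nonneg _) hu.2).trans ih
    have h2 : |s ^ a * (u - s)| ≤ |u - s| := by
      rw [abs_mul, abs_of_nonneg (pow_nonneg hs.1 a)]
      exact mul_le_of_le_one_left (abs_nonneg _) (pow_le_one₀ hs.1 hs.2)
    rw [e]
    push_cast
    linarith [abs_add_le ((u ^ a - s ^ a) * u) (s ^ a * (u - s))]

lemma abs_pow_sub_taylor_le {u s : ℝ} (hu : u ∈ Set.Icc (0 : ℝ) 1) (hs : s ∈ Set.Icc (0 : ℝ) 1)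
    (a : ℕ) : |u ^ a - s ^ a - a * s ^ (a - 1) * (u - s)| ≤ a ^ 2 * (u - s) ^ 2 := by
  induction a with
  | zero => simp
  | succ a ih =>
    have e : u ^ (a + 1) - s ^ (a + 1) - (a + 1 : ℕ) * s ^ (a + 1 - 1) * (u - s)
        = (u ^ a - s ^ a - a * s ^ (a - 1) * (u - s)) * s + (u ^ a - s ^ a) * (u - s) := by
      rcases a with _ | a
      · simp
      · simp only [Nat.add_sub_cancel]; push_cast; ring
    have h1 : |(u ^ a - s ^ a - a * s ^ (a - 1) * (u - s)) * s| ≤ a ^ 2 * (u - s) ^ 2 := by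
      rw [abs_mul, abs_of_nonneg hs.1]
      exact (mul_le_of_le_one_right (abs_nonneg _) hs.2).trans ih
    have h2 : |(u ^ a - s ^ a) * (u - s)| ≤ a * (u - s) ^ 2 := by
      rw [abs_mul, ← sq_abs (u - s), sq, ← mul_assoc]
      exact mul_le_mul_of_nonneg_right (abs_pow_sub_pow_le hu hs a) (abs_nonneg _)
    rw [e]
    push_cast
    have h3 : 0 ≤ (a + 1 : ℝ) * (u - s) ^ 2 := by positivity
    have := abs_add_le ((u ^ a - s ^ a - a * s ^ (a - 1) * (u - s)) * s)
      ((u ^ a - s ^ a) * (u - s))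
    nlinarith

lemma pow_mem_Icc {u : ℝ} (hu : u ∈ Set.Icc (0 : ℝ) 1) (a : ℕ) : u ^ a ∈ Set.Icc (0 : ℝ) 1 :=
  ⟨pow_nonneg hu.1 a, pow_le_one₀ hu.1 hu.2⟩

/-- First-order Taylor expansion of the monomial `u ^ a * v ^ b` on the unit square, with a
quadratic bound for the remainder. -/
lemma abs_monomial_sub_taylor_le {u s v t : ℝ} (hu : u ∈ Set.Icc (0 : ℝ) 1)
    (hs : s ∈ Set.Icc (0 : ℝ) 1) (hv : v ∈ Set.Icc (0 : ℝ) 1) (ht : t ∈ Set.Icc (0 : ℝ) 1)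
    (a b : ℕ) :
    |u ^ a * v ^ b - s ^ a * t ^ b - (a * (s ^ (a - 1) * t ^ b * u - s ^ (a - 1) * t ^ b * s)
      + b * (s ^ a * t ^ (b - 1) * v - s ^ a * t ^ (b - 1) * t))|
      ≤ (a + b : ℝ) ^ 2 * ((u - s) ^ 2 + (v - t) ^ 2) := by
  have e : u ^ a * v ^ b - s ^ a * t ^ b
      - (a * (s ^ (a - 1) * t ^ b * u - s ^ (a - 1) * t ^ b * s)
        + b * (s ^ a * t ^ (b - 1) * v - s ^ a * t ^ (b - 1) * t))
      = (u ^ a - s ^ a - a * s ^ (a - 1) * (u - s)) * t ^ b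
        + (v ^ b - t ^ b - b * t ^ (b - 1) * (v - t)) * s ^ a
        + (u ^ a - s ^ a) * (v ^ b - t ^ b) := by ring
  have h1 : |(u ^ a - s ^ a - a * s ^ (a - 1) * (u - s)) * t ^ b| ≤ a ^ 2 * (u - s) ^ 2 := by
    rw [abs_mul, abs_of_nonneg (pow_mem_Icc ht b).1]
    exact (mul_le_of_le_one_right (abs_nonneg _) (pow_mem_Icc ht b).2).trans
      (abs_pow_sub_taylor_le hu hs a)
  have h2 : |(v ^ b - t ^ b - b * t ^ (b - 1) * (v - t)) * s ^ a| ≤ b ^ 2 * (v - t) ^ 2 := by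
    rw [abs_mul, abs_of_nonneg (pow_mem_Icc hs a).1]
    exact (mul_le_of_le_one_right (abs_nonneg _) (pow_mem_Icc hs a).2).trans
      (abs_pow_sub_taylor_le hv ht b)
  have h3 : |(u ^ a - s ^ a) * (v ^ b - t ^ b)| ≤ (a * |u - s|) * (b * |v - t|) := by
    rw [abs_mul]
    exact mul_le_mul (abs_pow_sub_pow_le hu hs a) (abs_pow_sub_pow_le hv ht b) (abs_nonneg _)
      (by positivity)
  have h4 : (a * |u - s|) * (b * |v - t|) ≤ a * b * ((u - s) ^ 2 + (v - t) ^ 2) := by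
    have : |u - s| * |v - t| ≤ (u - s) ^ 2 + (v - t) ^ 2 := by
      rw [← sq_abs (u - s), ← sq_abs (v - t)]
      nlinarith [sq_nonneg (|u - s| - |v - t|), sq_nonneg (|u - s|), sq_nonneg (|v - t|)]
    calc (a * |u - s|) * (b * |v - t|) = a * b * (|u - s| * |v - t|) := by ring
      _ ≤ _ := by gcongr
  rw [e]
  refine (abs_add_three _ _ _).trans ?_
  have h5 : 0 ≤ (a : ℝ) * b * ((u - s) ^ 2 + (v - t) ^ 2) := by positivity
  have h6 : 0 ≤ (a : ℝ) ^ 2 * (v - t) ^ 2 := by positivity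
  have h7 : 0 ≤ (b : ℝ) ^ 2 * (u - s) ^ 2 := by positivity
  nlinarith

lemma abs_monomial_sub_le {u s v t : ℝ} (hu : u ∈ Set.Icc (0 : ℝ) 1)
    (hs : s ∈ Set.Icc (0 : ℝ) 1) (hv : v ∈ Set.Icc (0 : ℝ) 1) (ht : t ∈ Set.Icc (0 : ℝ) 1)
    (a b : ℕ) : |u ^ a * v ^ b - s ^ a * t ^ b| ≤ a * |u - s| + b * |v - t| := by
  have e : u ^ a * v ^ b - s ^ a * t ^ b = (u ^ a - s ^ a) * v ^ b + s ^ a * (v ^ b - t ^ b) := by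
    ring
  rw [e]
  refine (abs_add_le _ _).trans (add_le_add ?_ ?_)
  · rw [abs_mul, abs_of_nonneg (pow_mem_Icc hv b).1]
    exact (mul_le_of_le_one_right (abs_nonneg _) (pow_mem_Icc hv b).2).trans
      (abs_pow_sub_pow_le hu hs a)
  · rw [abs_mul, abs_of_nonneg (pow_mem_Icc hs a).1]
    exact (mul_le_of_le_one_left (abs_nonneg _) (pow_mem_Icc hs a).2).trans
      (abs_pow_sub_pow_le hv ht b)

lemma choose_div_choose_succ (N n a : ℕ) :
    (N.choose (a + 1) : ℝ) / n.choose (a + 1)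
      = (N.choose a : ℝ) / n.choose a * (((N : ℝ) - a) / ((n : ℝ) - a)) := by
  have key (M : ℕ) : (M.choose (a + 1) : ℝ) * (a + 1) = M.choose a * ((M : ℝ) - a) := by
    rcases le_or_gt a M with h | h
    · have := Nat.choose_succ_right_eq M a
      rw [← Nat.cast_sub h]
      exact_mod_cast this
    · simp [Nat.choose_eq_zero_of_lt h, Nat.choose_eq_zero_of_lt (h.trans (Nat.lt_succ_self a))]
  have ha : (a + 1 : ℝ) ≠ 0 := by positivity
  rw [div_mul_div_comm, ← key, ← key, mul_div_mul_right _ _ ha]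

lemma choose_div_choose_mem_Icc {N n : ℕ} (hN : N ≤ n) (a : ℕ) :
    (N.choose a : ℝ) / n.choose a ∈ Set.Icc (0 : ℝ) 1 :=
  ⟨by positivity, div_le_one_of_le₀ (by exact_mod_cast Nat.choose_le_choose a hN) (by positivity)⟩

lemma choose_div_choose_le {N n : ℕ} (hN : N ≤ n) {a : ℕ} (ha : 1 ≤ a) (han : a ≤ n) :
    (N.choose a : ℝ) / n.choose a ≤ N / n := by
  induction a, ha using Nat.le_induction with
  | base => simp
  | succ a ha ih =>
    refine le_trans ?_ (ih (by omega))
    rw [choose_div_choose_succ]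
    refine mul_le_of_le_one_right (choose_div_choose_mem_Icc hN a).1 ?_
    have : (a : ℝ) < n := by exact_mod_cast han
    rw [div_le_one (by linarith)]
    have : (N : ℝ) ≤ n := by exact_mod_cast hN
    linarith

/-- Sampling without replacement differs from sampling with replacement by `O(1/n)`, with a factor
`N / n` that makes the bound summable over the atoms. -/
lemma abs_choose_div_choose_sub_pow_le {N n : ℕ} (hN : N ≤ n) {a : ℕ} (han : 2 * a ≤ n) :
    |(N.choose a : ℝ) / n.choose a - ((N : ℝ) / n) ^ a| ≤ 2 * a ^ 2 / n * ((N : ℝ) / n) := by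
  induction a with
  | zero => simp
  | succ a ih =>
    have ih := ih (by omega)
    have hn : (0 : ℝ) < n := by
      have : 0 < n := by omega
      exact_mod_cast this
    have hNn : (N : ℝ) ≤ n := by exact_mod_cast hN
    have han' : 2 * ((a : ℝ) + 1) ≤ n := by exact_mod_cast han
    have ha0 : (0 : ℝ) ≤ a := by positivity
    have hu0 : 0 ≤ (N : ℝ) / n := by positivity
    have hu1 : (N : ℝ) / n ≤ 1 := div_le_one_of_le₀ hNn hn.le
    have hna : (0 : ℝ) < n - a := by linarith
    rw [choose_div_choose_succ]
    have hc := choose_div_choose_mem_Icc hN a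
    have hca : a * ((N.choose a : ℝ) / n.choose a) ≤ a * ((N : ℝ) / n) := by
      rcases Nat.eq_zero_or_pos a with rfl | h
      · simp
      · exact mul_le_mul_of_nonneg_left (choose_div_choose_le hN h (by omega)) ha0
    set c := (N.choose a : ℝ) / n.choose a with hcdef
    set u := (N : ℝ) / n with hu
    have hf : |((N : ℝ) - a) / (n - a) - u| ≤ 2 * a / n := by
      have e : ((N : ℝ) - a) / (n - a) - u = -(a * (n - N) / ((n - a) * n)) := by
        rw [hu]; field_simp; ring
      have hn2 : (n : ℝ) ≤ 2 * (n - a) := by linarith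
      rw [e, abs_neg, abs_of_nonneg (by
        have : (0 : ℝ) ≤ n - N := by linarith
        positivity), div_le_div_iff₀ (by positivity) hn]
      have h1 : (a : ℝ) * (n - N) ≤ a * n :=
        mul_le_mul_of_nonneg_left (by linarith [(Nat.cast_nonneg N : (0 : ℝ) ≤ N)]) ha0
      calc (a : ℝ) * (n - N) * n ≤ a * n * n := by gcongr
        _ ≤ a * (2 * (n - a)) * n := by gcongr
        _ = 2 * a * ((n - a) * n) := by ring
    have e : c * (((N : ℝ) - a) / (n - a)) - u ^ (a + 1)
        = c * (((N : ℝ) - a) / (n - a) - u) + (c - u ^ a) * u := by ring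
    rw [e]
    have h1 : |c * (((N : ℝ) - a) / (n - a) - u)| ≤ 2 * a / n * u := by
      rw [abs_mul, abs_of_nonneg hc.1]
      calc c * |((N : ℝ) - a) / (n - a) - u| ≤ c * (2 * a / n) := by gcongr
        _ = 2 / n * (a * c) := by ring
        _ ≤ 2 / n * (a * u) := by gcongr
        _ = _ := by ring
    have h2 : |(c - u ^ a) * u| ≤ 2 * a ^ 2 / n * u := by
      rw [abs_mul, abs_of_nonneg hu0]
      exact (mul_le_of_le_one_right (abs_nonneg _) hu1).trans ih
    refine (abs_add_le _ _).trans ((add_le_add h1 h2).trans ?_)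
    rw [← add_mul]
    refine mul_le_mul_of_nonneg_right ?_ hu0
    rw [← add_div]
    refine div_le_div_of_nonneg_right ?_ hn.le
    push_cast
    nlinarith

/-! ### Empirical frequencies and the coincidence statistic -/

open Classical in
/-- The number of indices `i < n` with `x i = k`. -/
noncomputable def empCount {α : Type*} (x : ℕ → α) (n : ℕ) (k : α) : ℕ :=
  ((Finset.range n).filter (fun i => x i = k)).card

/-- The empirical frequency of the value `k` among `x 0, …, x (n - 1)`. -/
noncomputable def empFreq {α : Type*} (x : ℕ → α) (n : ℕ) (k : α) : ℝ := (empCount x n k : ℝ) / n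

section
variable {α : Type*}

lemma empCount_le (x : ℕ → α) (n : ℕ) (k : α) : empCount x n k ≤ n := by
  classical
  exact (Finset.card_filter_le _ _).trans (by simp)

lemma empFreq_mem_Icc (x : ℕ → α) (n : ℕ) (k : α) : empFreq x n k ∈ Set.Icc (0 : ℝ) 1 :=
  ⟨by unfold empFreq; positivity,
    div_le_one_of_le₀ (by exact_mod_cast empCount_le x n k) (by positivity)⟩

lemma empCount_eq_zero [DecidableEq α] {x : ℕ → α} {n : ℕ} {k : α}
    (hk : k ∉ (Finset.range n).image x) :
    empCount x n k = 0 := by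
  simp only [Finset.mem_image, not_exists, not_and] at hk
  simpa [empCount, Finset.filter_eq_empty_iff] using hk

open Classical in
lemma empFreq_eq_sum (x : ℕ → α) (n : ℕ) (k : α) :
    empFreq x n k = (n : ℝ)⁻¹ * ∑ i ∈ Finset.range n, if x i = k then (1 : ℝ) else 0 := by
  rw [empFreq, empCount, div_eq_inv_mul]
  simp

/-- Integration against the empirical measure is averaging over the sample. -/
lemma hasSum_mul_empFreq (g : α → ℝ) (x : ℕ → α) (n : ℕ) :
    HasSum (fun k => g k * empFreq x n k) ((n : ℝ)⁻¹ * ∑ i ∈ Finset.range n, g (x i)) := by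
  classical
  have h (i : ℕ) : HasSum (fun k => if x i = k then g k else 0) (g (x i)) := by
    have h := hasSum_single (f := fun k => if x i = k then g k else 0) (x i)
      (fun k hk => if_neg (Ne.symm hk))
    simpa using h
  have h2 := (hasSum_sum (s := Finset.range n) (fun i _ => h i)).mul_left (n : ℝ)⁻¹
  convert! h2 using 2 with k
  rw [empFreq_eq_sum, mul_left_comm, Finset.mul_sum]
  simp

lemma summable_empFreq (x : ℕ → α) (n : ℕ) : Summable (empFreq x n) := by
  simpa using (hasSum_mul_empFreq (fun _ => 1) x n).summable

lemma tsum_empFreq (x : ℕ → α) {n : ℕ} (hn : 1 ≤ n) : ∑' k, empFreq x n k = 1 := by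
  have h := (hasSum_mul_empFreq (fun _ => 1) x n).tsum_eq
  have : (n : ℝ) ≠ 0 := by positivity
  simpa [this] using h

end

lemma toEuclid_injective {d : ℕ} : Function.Injective (toEuclid (d := d)) := by
  intro k l h
  funext i
  have := congrFun (congrArg WithLp.ofLp h) i
  simpa [toEuclid] using this

open Classical in
lemma psi_zero_eq {d : ℕ} (x y : ℕ → Fin d → ℕ) {S T : Finset ℕ} {n : ℕ}
    (hS : S.Nonempty) (hSn : S ⊆ Finset.range n) :
    psi 0 (fun i => toEuclid (x i)) (fun i => toEuclid (y i)) S T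
      = ∑ k ∈ (Finset.range n).image x,
          (if ∀ j ∈ S, x j = k then (1 : ℝ) else 0) * (if ∀ j ∈ T, y j = k then 1 else 0) := by
  have hat (i : ℕ) : psiAt 0 (fun i => toEuclid (x i)) (fun i => toEuclid (y i)) S T i
      = (if ∀ j ∈ S, x j = x i then (1 : ℝ) else 0) * (if ∀ j ∈ T, y j = x i then 1 else 0) := by
    simp only [psiAt, dist_le_zero, toEuclid_injective.eq_iff, ite_and, mul_ite, mul_one, mul_zero,
      eq_comm (a := x i)]
    split_ifs <;> rfl
  obtain ⟨i₀, hi₀⟩ := hS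
  have hsum : ∑ k ∈ (Finset.range n).image x,
      (if ∀ j ∈ S, x j = k then (1 : ℝ) else 0) * (if ∀ j ∈ T, y j = k then 1 else 0)
      = (if ∀ j ∈ S, x j = x i₀ then (1 : ℝ) else 0) * (if ∀ j ∈ T, y j = x i₀ then 1 else 0) := by
    refine Finset.sum_eq_single_of_mem _ (Finset.mem_image_of_mem x (hSn hi₀)) fun k _ hk => ?_
    rw [if_neg (fun h => hk (h i₀ hi₀).symm), zero_mul]
  rw [hsum, psi]
  have hconst : ∀ i ∈ S, psiAt 0 (fun i => toEuclid (x i)) (fun i => toEuclid (y i)) S T i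
      = (if ∀ j ∈ S, x j = x i₀ then (1 : ℝ) else 0)
        * (if ∀ j ∈ T, y j = x i₀ then 1 else 0) := by
    intro i hi
    rw [hat]
    by_cases h : ∀ j ∈ S, x j = x i₀
    · rw [h i hi]
    · have h' : ¬ ∀ j ∈ S, x j = x i := fun h' => h fun j hj => by rw [h' j hj, ← h' i₀ hi₀]
      rw [if_neg h, if_neg h', zero_mul, zero_mul]
  have hcard : (S.card : ℝ) ≠ 0 := by exact_mod_cast (Finset.card_pos.2 ⟨i₀, hi₀⟩).ne'
  rw [Finset.sum_congr rfl hconst, Finset.sum_const, nsmul_eq_mul, inv_mul_cancel_left₀ hcard]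

lemma sum_powersetCard_coincide {α : Type*} [DecidableEq α] (x : ℕ → α) (n a : ℕ) (k : α) :
    ∑ S ∈ (Finset.range n).powersetCard a, (if ∀ j ∈ S, x j = k then (1 : ℝ) else 0)
      = (empCount x n k).choose a := by
  rw [Finset.sum_boole, empCount, ← Finset.card_powersetCard]
  congr 2
  ext S
  simp only [Finset.mem_filter, Finset.mem_powersetCard, Finset.subset_iff]
  grind

/-- The `U`-statistic is a function of the two empirical count vectors. -/
lemma Q_eq_tsum {d : ℕ} (n₁ n₂ : ℕ) {a : ℕ} (b : ℕ) (ha : 1 ≤ a) (x y : ℕ → Fin d → ℕ) :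
    Q n₁ n₂ a b x y = ∑' k, ((empCount x n₁ k).choose a : ℝ) / n₁.choose a
      * (((empCount y n₂ k).choose b : ℝ) / n₂.choose b) := by
  classical
  rw [tsum_eq_sum (s := (Finset.range n₁).image x) (fun k hk => by
    rw [empCount_eq_zero hk, Nat.choose_eq_zero_of_lt ha]; simp)]
  have h : ∀ S ∈ (Finset.range n₁).powersetCard a, ∀ T ∈ (Finset.range n₂).powersetCard b,
      psi 0 (fun i => toEuclid (x i)) (fun i => toEuclid (y i)) S T
      = ∑ k ∈ (Finset.range n₁).image x,
          (if ∀ j ∈ S, x j = k then (1 : ℝ) else 0) * (if ∀ j ∈ T, y j = k then 1 else 0) := by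
    intro S hS T _
    rw [Finset.mem_powersetCard] at hS
    exact psi_zero_eq x y (Finset.card_pos.1 (by omega)) hS.1
  rw [Q, uStat, Finset.sum_congr rfl fun S hS => Finset.sum_congr rfl fun T hT => h S hS T hT]
  rw [Finset.sum_congr rfl fun S _ => Finset.sum_comm, Finset.sum_comm, Finset.mul_sum]
  refine Finset.sum_congr rfl fun k _ => ?_
  rw [← Finset.sum_mul_sum, sum_powersetCard_coincide, sum_powersetCard_coincide]
  ring

section
variable {α : Type*}

lemma summable_monomial {u v : α → ℝ} (hu : ∀ k, u k ∈ Set.Icc (0 : ℝ) 1)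
    (hv : ∀ k, v k ∈ Set.Icc (0 : ℝ) 1) (hus : Summable u) {a : ℕ} (ha : 1 ≤ a) (b : ℕ) :
    Summable fun k => u k ^ a * v k ^ b := by
  refine Summable.of_nonneg_of_le (fun k => mul_nonneg (pow_mem_Icc (hu k) a).1
    (pow_mem_Icc (hv k) b).1) (fun k => ?_) hus
  refine (mul_le_of_le_one_right (pow_mem_Icc (hu k) a).1 (pow_mem_Icc (hv k) b).2).trans ?_
  exact pow_le_of_le_one (hu k).1 (hu k).2 (by omega)

lemma summable_mul_of_mem_Icc {g w : α → ℝ} (hg : ∀ k, g k ∈ Set.Icc (0 : ℝ) 1)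
    (hw : ∀ k, w k ∈ Set.Icc (0 : ℝ) 1) (hws : Summable w) : Summable fun k => g k * w k :=
  Summable.of_nonneg_of_le (fun k => mul_nonneg (hg k).1 (hw k).1)
    (fun k => mul_le_of_le_one_left (hw k).1 (hg k).2) hws

lemma summable_sub_sq {u s : α → ℝ} (hu : ∀ k, u k ∈ Set.Icc (0 : ℝ) 1)
    (hs : ∀ k, s k ∈ Set.Icc (0 : ℝ) 1) (hus : Summable u) (hss : Summable s) :
    Summable fun k => (u k - s k) ^ 2 := by
  refine Summable.of_nonneg_of_le (fun k => sq_nonneg _) (fun k => ?_) (hus.add hss)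
  have := hu k; have := hs k
  rw [Set.mem_Icc] at *
  nlinarith [mul_nonneg (hu k).1 (hs k).1]

lemma summable_abs_sub {u s : α → ℝ} (hus : Summable u) (hss : Summable s) :
    Summable fun k => |u k - s k| := (hus.sub hss).abs

/-- The functional `∑ u ^ a * v ^ b` of a pair of frequency vectors is differentiable at `(s, t)`,
with a remainder controlled by the squared `ℓ²` distances. -/
lemma abs_tsum_monomial_sub_taylor_le {u s v t : α → ℝ} (hu : ∀ k, u k ∈ Set.Icc (0 : ℝ) 1)
    (hs : ∀ k, s k ∈ Set.Icc (0 : ℝ) 1) (hv : ∀ k, v k ∈ Set.Icc (0 : ℝ) 1)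
    (ht : ∀ k, t k ∈ Set.Icc (0 : ℝ) 1) (hus : Summable u) (hss : Summable s)
    (hvs : Summable v) (hts : Summable t) {a : ℕ} (ha : 1 ≤ a) (b : ℕ) :
    |∑' k, u k ^ a * v k ^ b - ∑' k, s k ^ a * t k ^ b
      - (a * (∑' k, s k ^ (a - 1) * t k ^ b * u k - ∑' k, s k ^ (a - 1) * t k ^ b * s k)
      + b * (∑' k, s k ^ a * t k ^ (b - 1) * v k - ∑' k, s k ^ a * t k ^ (b - 1) * t k))|
      ≤ (a + b : ℝ) ^ 2 * (∑' k, (u k - s k) ^ 2 + ∑' k, (v k - t k) ^ 2) := by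
  have hg1 : ∀ k, s k ^ (a - 1) * t k ^ b ∈ Set.Icc (0 : ℝ) 1 := fun k =>
    ⟨mul_nonneg (pow_mem_Icc (hs k) _).1 (pow_mem_Icc (ht k) _).1,
      mul_le_one₀ (pow_mem_Icc (hs k) _).2 (pow_mem_Icc (ht k) _).1 (pow_mem_Icc (ht k) _).2⟩
  have hg2 : ∀ k, s k ^ a * t k ^ (b - 1) ∈ Set.Icc (0 : ℝ) 1 := fun k =>
    ⟨mul_nonneg (pow_mem_Icc (hs k) _).1 (pow_mem_Icc (ht k) _).1,
      mul_le_one₀ (pow_mem_Icc (hs k) _).2 (pow_mem_Icc (ht k) _).1 (pow_mem_Icc (ht k) _).2⟩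
  have hL := (((summable_monomial hu hv hus ha b).hasSum.sub
    (summable_monomial hs ht hss ha b).hasSum).sub
    ((((summable_mul_of_mem_Icc hg1 hu hus).hasSum.sub
        (summable_mul_of_mem_Icc hg1 hs hss).hasSum).mul_left (a : ℝ)).add
      (((summable_mul_of_mem_Icc hg2 hv hvs).hasSum.sub
        (summable_mul_of_mem_Icc hg2 ht hts).hasSum).mul_left (b : ℝ))))
  have hR := ((summable_sub_sq hu hs hus hss).hasSum.add
    (summable_sub_sq hv ht hvs hts).hasSum).mul_left ((a + b : ℝ) ^ 2)
  rw [abs_le]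
  have hpt := fun k => abs_le.1 (abs_monomial_sub_taylor_le (hu k) (hs k) (hv k) (ht k) a b)
  exact ⟨hasSum_le (fun k => (hpt k).1) hR.neg hL, hasSum_le (fun k => (hpt k).2) hL hR⟩

lemma abs_tsum_monomial_sub_le {u s v t : α → ℝ} (hu : ∀ k, u k ∈ Set.Icc (0 : ℝ) 1)
    (hs : ∀ k, s k ∈ Set.Icc (0 : ℝ) 1) (hv : ∀ k, v k ∈ Set.Icc (0 : ℝ) 1)
    (ht : ∀ k, t k ∈ Set.Icc (0 : ℝ) 1) (hus : Summable u) (hss : Summable s)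
    (hvs : Summable v) (hts : Summable t) {a : ℕ} (ha : 1 ≤ a) (b : ℕ) :
    |∑' k, u k ^ a * v k ^ b - ∑' k, s k ^ a * t k ^ b|
      ≤ a * ∑' k, |u k - s k| + b * ∑' k, |v k - t k| := by
  have hL := (summable_monomial hu hv hus ha b).hasSum.sub
    (summable_monomial hs ht hss ha b).hasSum
  have hR := ((summable_abs_sub hus hss).hasSum.mul_left (a : ℝ)).add
    ((summable_abs_sub hvs hts).hasSum.mul_left (b : ℝ))
  rw [abs_le]
  have hpt := fun k => abs_le.1 (abs_monomial_sub_le (hu k) (hs k) (hv k) (ht k) a b)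
  exact ⟨hasSum_le (fun k => (hpt k).1) hR.neg hL, hasSum_le (fun k => (hpt k).2) hL hR⟩

end

/-- The `U`-statistic differs from the corresponding plug-in (`V`-)statistic by a nonrandom
`O(1/n)`. -/
lemma abs_Q_sub_plugin_le {d : ℕ} {n₁ n₂ a b : ℕ} (ha : 1 ≤ a) (h₁ : 2 * a ≤ n₁)
    (h₂ : 2 * b ≤ n₂) (x y : ℕ → Fin d → ℕ) :
    |Q n₁ n₂ a b x y - ∑' k, empFreq x n₁ k ^ a * empFreq y n₂ k ^ b|
      ≤ 2 * a ^ 2 / n₁ + 2 * b ^ 2 / n₂ := by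
  rw [Q_eq_tsum n₁ n₂ b ha]
  have hux := empFreq_mem_Icc x n₁
  have hvy := empFreq_mem_Icc y n₂
  have hsum := summable_empFreq x n₁
  have hcx := fun k => choose_div_choose_mem_Icc (empCount_le x n₁ k) a
  have hcy := fun k => choose_div_choose_mem_Icc (empCount_le y n₂ k) b
  have hs1 : Summable fun k => ((empCount x n₁ k).choose a : ℝ) / n₁.choose a
      * (((empCount y n₂ k).choose b : ℝ) / n₂.choose b) := by
    refine Summable.of_nonneg_of_le (fun k => mul_nonneg (hcx k).1 (hcy k).1) (fun k => ?_) hsum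
    exact (mul_le_of_le_one_right (hcx k).1 (hcy k).2).trans
      (choose_div_choose_le (empCount_le x n₁ k) ha (by omega))
  have hL := hs1.hasSum.sub (summable_monomial hux hvy hsum ha b).hasSum
  have hR : HasSum (fun k => (2 * a ^ 2 / n₁ + 2 * b ^ 2 / n₂ : ℝ) * empFreq x n₁ k)
      (2 * a ^ 2 / n₁ + 2 * b ^ 2 / n₂ : ℝ) := by
    simpa [tsum_empFreq x (by omega : 1 ≤ n₁)] using
      hsum.hasSum.mul_left (2 * a ^ 2 / n₁ + 2 * b ^ 2 / n₂ : ℝ)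
  have hpt : ∀ k, |((empCount x n₁ k).choose a : ℝ) / n₁.choose a
      * (((empCount y n₂ k).choose b : ℝ) / n₂.choose b) - empFreq x n₁ k ^ a * empFreq y n₂ k ^ b|
      ≤ (2 * a ^ 2 / n₁ + 2 * b ^ 2 / n₂ : ℝ) * empFreq x n₁ k := by
    intro k
    have e1 := abs_choose_div_choose_sub_pow_le (empCount_le x n₁ k) h₁
    have e2 := abs_choose_div_choose_sub_pow_le (empCount_le y n₂ k) h₂
    change |_ - empFreq x n₁ k ^ a| ≤ _ * empFreq x n₁ k at e1
    change |_ - empFreq y n₂ k ^ b| ≤ _ * empFreq y n₂ k at e2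
    have e2' := e2.trans (mul_le_of_le_one_right (by positivity) (hvy k).2)
    rw [show ∀ c c' u v : ℝ, c * c' - u * v = (c - u) * c' + u * (c' - v) by intros; ring, add_mul]
    refine (abs_add_le _ _).trans (add_le_add ?_ ?_)
    · rw [abs_mul, abs_of_nonneg (hcy k).1]
      exact (mul_le_of_le_one_right (abs_nonneg _) (hcy k).2).trans e1
    · rw [abs_mul, abs_of_nonneg (pow_mem_Icc (hux k) a).1, mul_comm]
      exact mul_le_mul e2' (pow_le_of_le_one (hux k).1 (hux k).2 (by omega))
        (pow_mem_Icc (hux k) a).1 (by positivity)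
  rw [abs_le]
  exact ⟨hasSum_le (fun k => (abs_le.1 (hpt k)).1) hR.neg hL,
    hasSum_le (fun k => (abs_le.1 (hpt k)).2) hL hR⟩

/-! ### Laws of large numbers for empirical frequencies -/

section
variable {α : Type*}

lemma pmf_toReal_mem_Icc (μ : PMF α) (k : α) : (μ k).toReal ∈ Set.Icc (0 : ℝ) 1 :=
  ⟨ENNReal.toReal_nonneg, ENNReal.toReal_mono ENNReal.one_ne_top (μ.coe_le_one k)⟩

lemma hasSum_pmf_toReal (μ : PMF α) : HasSum (fun k => (μ k).toReal) 1 := by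
  have h := ENNReal.hasSum_toReal (f := μ) (by simp [μ.tsum_coe])
  rwa [← ENNReal.tsum_toReal_eq (fun k => μ.apply_ne_top k), μ.tsum_coe] at h

lemma ite_eq_mem_Icc [DecidableEq α] (k l : α) :
    (if l = k then (1 : ℝ) else 0) ∈ Set.Icc (0 : ℝ) 1 := by
  split_ifs <;> simp

lemma tsum_ite_mul_pmf [DecidableEq α] (μ : PMF α) (k : α) :
    ∑' l, (if l = k then (1 : ℝ) else 0) * (μ l).toReal = (μ k).toReal := by
  rw [tsum_eq_single k (fun l hl => by rw [if_neg hl, zero_mul]), if_pos rfl, one_mul]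

lemma ofReal_tsum_empFreq_sub_sq (μ : PMF α) (x : ℕ → α) (n : ℕ) :
    ENNReal.ofReal (∑' k, (empFreq x n k - (μ k).toReal) ^ 2)
      = ∑' k, ENNReal.ofReal ((empFreq x n k - (μ k).toReal) ^ 2) :=
  ENNReal.ofReal_tsum_of_nonneg (fun _ => sq_nonneg _)
    (summable_sub_sq (empFreq_mem_Icc _ n) (pmf_toReal_mem_Icc μ) (summable_empFreq _ n)
      (hasSum_pmf_toReal μ).summable)

variable [MeasurableSpace α] [Countable α] [MeasurableSingletonClass α]

lemma integral_pmf_eq_tsum (μ : PMF α) {g : α → ℝ} (hg : ∀ k, g k ∈ Set.Icc (0 : ℝ) 1) :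
    ∫ k, g k ∂μ.toMeasure = ∑' k, g k * (μ k).toReal := by
  rw [PMF.integral_eq_tsum]
  · simp [mul_comm]
  · exact Integrable.of_bound (measurable_of_countable g).aestronglyMeasurable 1
      (ae_of_all _ fun k => by rw [Real.norm_eq_abs, abs_of_nonneg (hg k).1]; exact (hg k).2)

variable {Ω : Type*} [MeasurableSpace Ω] {P : Measure Ω}
  {X : ℕ → Ω → α} {μ : PMF α}

lemma integral_comp_eq_tsum (hXm : ∀ i, Measurable (X i))
    (hXlaw : ∀ i, P.map (X i) = μ.toMeasure) {g : α → ℝ} (hg : ∀ k, g k ∈ Set.Icc (0 : ℝ) 1)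
    (i : ℕ) : ∫ ω, g (X i ω) ∂P = ∑' k, g k * (μ k).toReal := by
  rw [← integral_pmf_eq_tsum μ hg, ← hXlaw i, integral_map (hXm i).aemeasurable
    (measurable_of_countable g).aestronglyMeasurable]

lemma identDistrib_comp (hXm : ∀ i, Measurable (X i))
    (hXlaw : ∀ i, P.map (X i) = μ.toMeasure) (g : α → ℝ) (i : ℕ) :
    IdentDistrib (fun ω => g (X i ω)) (fun ω => g (X 0 ω)) P P :=
  (IdentDistrib.mk (hXm i).aemeasurable (hXm 0).aemeasurable
    ((hXlaw i).trans (hXlaw 0).symm)).comp (measurable_of_countable g)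

variable [IsProbabilityMeasure P]

lemma memLp_comp_of_mem_Icc (hXm : ∀ i, Measurable (X i)) {g : α → ℝ}
    (hg : ∀ k, g k ∈ Set.Icc (0 : ℝ) 1) (p : ENNReal) (i : ℕ) :
    MemLp (fun ω => g (X i ω)) p P :=
  MemLp.of_bound ((measurable_of_countable g).comp (hXm i)).aestronglyMeasurable 1
    (ae_of_all _ fun ω => by
      rw [Real.norm_eq_abs, abs_of_nonneg (hg (X i ω)).1]; exact (hg (X i ω)).2)

lemma ae_tendsto_mean (hXm : ∀ i, Measurable (X i)) (hXlaw : ∀ i, P.map (X i) = μ.toMeasure)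
    (hX : iIndepFun X P) {g : α → ℝ} (hg : ∀ k, g k ∈ Set.Icc (0 : ℝ) 1) :
    ∀ᵐ ω ∂P, Tendsto (fun n : ℕ => (n : ℝ)⁻¹ * ∑ i ∈ Finset.range n, g (X i ω)) atTop
      (𝓝 (∑' k, g k * (μ k).toReal)) := by
  have h := strong_law_ae (μ := P) (fun i ω => g (X i ω))
    (memLp_one_iff_integrable.1 (memLp_comp_of_mem_Icc hXm hg 1 0))
    (fun i j hij => (hX.indepFun hij).comp (measurable_of_countable g) (measurable_of_countable g))
    (identDistrib_comp hXm hXlaw g)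
  simpa only [integral_comp_eq_tsum hXm hXlaw hg, smul_eq_mul] using h

/-- Almost sure convergence of the empirical law in total variation: the strong law gives
convergence at each atom, and Scheffé's argument upgrades it to `ℓ¹`. -/
lemma ae_tendsto_tsum_abs_empFreq_sub (hXm : ∀ i, Measurable (X i))
    (hXlaw : ∀ i, P.map (X i) = μ.toMeasure) (hX : iIndepFun X P) :
    ∀ᵐ ω ∂P, Tendsto (fun n : ℕ => ∑' k, |empFreq (fun i => X i ω) n k - (μ k).toReal|) atTop
      (𝓝 0) := by
  classical
  have h : ∀ᵐ ω ∂P, ∀ k, Tendsto (fun n : ℕ => empFreq (fun i => X i ω) n k) atTop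
      (𝓝 (μ k).toReal) := by
    rw [ae_all_iff]
    intro k
    have := ae_tendsto_mean hXm hXlaw hX (g := fun l => if l = k then 1 else 0)
      (ite_eq_mem_Icc k)
    rw [tsum_ite_mul_pmf] at this
    simpa only [empFreq_eq_sum] using this
  filter_upwards [h] with ω hω
  have hs := hasSum_pmf_toReal μ
  -- both frequency vectors sum to `1`, so the `ℓ¹` distance is twice the sum of the positive
  -- parts of `μ - empFreq`, which is dominated by `μ`
  have hdom : Tendsto (fun n : ℕ => ∑' k, 2 * max ((μ k).toReal - empFreq (fun i => X i ω) n k) 0)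
      atTop (𝓝 (∑' _ : α, (0 : ℝ))) := by
    refine tendsto_tsum_of_dominated_convergence (bound := fun k => 2 * (μ k).toReal)
      (hs.summable.mul_left 2) (fun k => ?_) (Eventually.of_forall fun n k => ?_)
    · have := (((hω k).const_sub (μ k).toReal).max
        (tendsto_const_nhds (x := (0 : ℝ)))).const_mul 2
      simpa using this
    · rw [Real.norm_eq_abs, abs_of_nonneg (by positivity)]
      have := (empFreq_mem_Icc (fun i => X i ω) n k).1
      have := (pmf_toReal_mem_Icc μ k).1
      gcongr
      exact max_le (by linarith) (by linarith)
  rw [tsum_zero] at hdom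
  refine hdom.congr' ?_
  filter_upwards [eventually_ge_atTop 1] with n hn
  have hu := (summable_empFreq (fun i => X i ω) n).hasSum
  rw [tsum_empFreq _ hn] at hu
  have habs := (summable_abs_sub hu.summable hs.summable).hasSum
  have hsub := habs.sub (hu.sub hs)
  rw [sub_self, sub_zero] at hsub
  rw [← hsub.tsum_eq]
  refine tsum_congr fun k => ?_
  rcases le_total (empFreq (fun i => X i ω) n k) (μ k).toReal with hle | hle
  · rw [max_eq_left (by linarith), abs_of_nonpos (by linarith)]; ring
  · rw [max_eq_right (by linarith), abs_of_nonneg (by linarith)]; ring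

lemma measurable_empFreq (hXm : ∀ i, Measurable (X i)) (n : ℕ) (k : α) :
    Measurable fun ω => empFreq (fun i => X i ω) n k := by
  classical
  simp only [empFreq_eq_sum]
  refine Measurable.const_mul (Finset.measurable_sum _ fun i _ => ?_) _
  exact (measurable_of_countable (fun l : α => if l = k then (1 : ℝ) else 0)).comp (hXm i)

lemma lintegral_empFreq_sub_sq_le (hXm : ∀ i, Measurable (X i))
    (hXlaw : ∀ i, P.map (X i) = μ.toMeasure) (hX : iIndepFun X P) {n : ℕ} (hn : 1 ≤ n) (k : α) :
    ∫⁻ ω, ENNReal.ofReal ((empFreq (fun i => X i ω) n k - (μ k).toReal) ^ 2) ∂P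
      ≤ ENNReal.ofReal ((n : ℝ)⁻¹ * (μ k).toReal) := by
  classical
  set g : α → ℝ := fun l => if l = k then 1 else 0 with hgdef
  have hg : ∀ l, g l ∈ Set.Icc (0 : ℝ) 1 := ite_eq_mem_Icc k
  have hn0 : (n : ℝ) ≠ 0 := by positivity
  have hmean (i : ℕ) : ∫ ω, g (X i ω) ∂P = (μ k).toReal := by
    rw [integral_comp_eq_tsum hXm hXlaw hg, tsum_ite_mul_pmf]
  have hemp : (fun ω => empFreq (fun i => X i ω) n k)
      = fun ω => (n : ℝ)⁻¹ * (∑ i ∈ Finset.range n, fun ω => g (X i ω)) ω := by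
    funext ω
    rw [empFreq_eq_sum, Finset.sum_apply]
  have hmem : MemLp (fun ω => empFreq (fun i => X i ω) n k) 2 P := by
    rw [hemp]
    exact (memLp_finsetSum' _ fun i _ => memLp_comp_of_mem_Icc hXm hg 2 i).const_mul _
  have hEemp : ∫ ω, empFreq (fun i => X i ω) n k ∂P = (μ k).toReal := by
    rw [hemp]
    simp only [Finset.sum_apply]
    rw [integral_const_mul, integral_finsetSum _ fun i _ =>
      memLp_one_iff_integrable.1 (memLp_comp_of_mem_Icc hXm hg 1 i)]
    rw [Finset.sum_congr rfl fun i _ => hmean i]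
    simp [hn0]
  have hvar1 (i : ℕ) : Var[fun ω => g (X i ω); P] ≤ (μ k).toReal := by
    rw [variance_eq_sub (memLp_comp_of_mem_Icc hXm hg 2 i), hmean]
    have : (fun ω => g (X i ω)) ^ 2 = fun ω => g (X i ω) := by
      funext ω
      simp only [Pi.pow_apply, hgdef]
      split_ifs <;> simp
    rw [this, hmean]
    nlinarith [sq_nonneg (μ k).toReal]
  have hvar : Var[fun ω => empFreq (fun i => X i ω) n k; P] ≤ (n : ℝ)⁻¹ * (μ k).toReal := by
    rw [hemp, variance_const_mul, IndepFun.variance_sum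
      (fun i _ => memLp_comp_of_mem_Icc hXm hg 2 i)
      (fun i _ j _ hij => (hX.indepFun hij).comp (measurable_of_countable g)
        (measurable_of_countable g))]
    calc (n : ℝ)⁻¹ ^ 2 * ∑ i ∈ Finset.range n, Var[fun ω => g (X i ω); P]
        ≤ (n : ℝ)⁻¹ ^ 2 * ∑ i ∈ Finset.range n, (μ k).toReal := by
          gcongr with i _
          exact hvar1 i
      _ = _ := by rw [Finset.sum_const, Finset.card_range, nsmul_eq_mul]; field_simp
  rw [← ofReal_integral_eq_lintegral_ofReal]
  · refine ENNReal.ofReal_le_ofReal ?_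
    rwa [variance_eq_integral hmem.aestronglyMeasurable.aemeasurable, hEemp] at hvar
  · exact (hmem.sub (memLp_const _)).integrable_sq
  · exact ae_of_all _ fun ω => sq_nonneg _

lemma measurable_ofReal_tsum_empFreq_sub_sq (μ : PMF α) (hXm : ∀ i, Measurable (X i)) (n : ℕ) :
    Measurable fun ω =>
      ENNReal.ofReal (∑' k, (empFreq (fun i => X i ω) n k - (μ k).toReal) ^ 2) := by
  simp only [ofReal_tsum_empFreq_sub_sq]
  exact Measurable.tsum fun k =>
    (((measurable_empFreq hXm n k).sub_const _).pow_const 2).ennreal_ofReal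

/-- The expected squared `ℓ²` distance of the empirical law to the true law is at most `1/n`. -/
lemma lintegral_tsum_empFreq_sub_sq_le (hXm : ∀ i, Measurable (X i))
    (hXlaw : ∀ i, P.map (X i) = μ.toMeasure) (hX : iIndepFun X P) {n : ℕ} (hn : 1 ≤ n) :
    ∫⁻ ω, ENNReal.ofReal (∑' k, (empFreq (fun i => X i ω) n k - (μ k).toReal) ^ 2) ∂P
      ≤ ENNReal.ofReal (n : ℝ)⁻¹ := by
  have hs := hasSum_pmf_toReal μ
  simp only [ofReal_tsum_empFreq_sub_sq]
  rw [lintegral_tsum fun k => (((measurable_empFreq hXm n k).sub_const _).pow_const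
    2).ennreal_ofReal.aemeasurable]
  refine (ENNReal.tsum_le_tsum fun k => lintegral_empFreq_sub_sq_le hXm hXlaw hX hn k).trans ?_
  rw [← ENNReal.ofReal_tsum_of_nonneg (fun k => by positivity) (hs.summable.mul_left _),
    tsum_mul_left, hs.tsum_eq, mul_one]

end

/-! ### Convergence in distribution to a centred Gaussian -/

section
variable {Ω : Type*} [MeasurableSpace Ω] {P : Measure Ω} [IsProbabilityMeasure P]

lemma tendstoInDistribution_of_map_eq {Ω' Ω'' : Type*} [MeasurableSpace Ω'] [MeasurableSpace Ω'']
    {P' : Measure Ω'} {P'' : Measure Ω''} [IsProbabilityMeasure P'] [IsProbabilityMeasure P'']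
    {W : ℕ → Ω → ℝ} {Z : Ω' → ℝ} {Z' : Ω'' → ℝ}
    (hW : TendstoInDistribution W atTop Z (fun _ => P) P') (hZ' : AEMeasurable Z' P'')
    (hmap : P'.map Z = P''.map Z') : TendstoInDistribution W atTop Z' (fun _ => P) P'' where
  forall_aemeasurable := hW.forall_aemeasurable
  aemeasurable_limit := hZ'
  tendsto := by
    have h := hW.tendsto
    simp only [hmap] at h
    exact h

/-- Slutsky's theorem in the form used below: a factor that converges almost surely to a constant
rescales the Gaussian limit. The product formula is only needed eventually, almost surely. -/
lemma tendstoInDistribution_gaussian_mul {W F V : ℕ → Ω → ℝ} {v w : NNReal} {c : ℝ}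
    (hW : TendstoInDistribution W atTop (fun z : ℝ => z) (fun _ => P) (gaussianReal 0 v))
    (hF : ∀ m, Measurable (F m)) (hV : ∀ m, Measurable (V m))
    (hFc : ∀ᵐ ω ∂P, Tendsto (fun m => F m ω) atTop (𝓝 c))
    (hVe : ∀ᵐ ω ∂P, ∀ᶠ m in atTop, V m ω = W m ω * F m ω) (hw : (w : ℝ) = c ^ 2 * v) :
    TendstoInDistribution V atTop (fun z : ℝ => z) (fun _ => P) (gaussianReal 0 w) := by
  have hprod := hW.continuous_comp_prodMk_of_tendstoInMeasure_const
    (g := fun x : ℝ × ℝ => x.1 * x.2) (by fun_prop)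
    (tendstoInMeasure_of_tendsto_ae (fun m => (hF m).aestronglyMeasurable) hFc)
    (fun m => (hF m).aemeasurable)
  have hlim : (gaussianReal 0 v).map (fun z => z * c) = (gaussianReal 0 w).map (fun z => z) := by
    rw [gaussianReal_map_mul_const, Measure.map_id']
    congr 1
    · simp
    · ext; simpa using hw.symm
  refine tendstoInDistribution_of_map_eq (Z := fun z => z * c) ?_ (by fun_prop) hlim
  refine tendstoInDistribution_of_tendstoInMeasure_sub V _ hprod ?_ fun m => (hV m).aemeasurable
  refine tendstoInMeasure_of_tendsto_ae
    (fun m => ((hV m).aemeasurable.sub (hprod.forall_aemeasurable m)).aestronglyMeasurable) ?_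
  filter_upwards [hVe] with ω hω
  refine tendsto_const_nhds.congr' ?_
  filter_upwards [hω] with m hm
  simp [hm]

lemma tendstoInDistribution_gaussian_add {A B : ℕ → Ω → ℝ} {v w : NNReal}
    (hA : TendstoInDistribution A atTop (fun z : ℝ => z) (fun _ => P) (gaussianReal 0 v))
    (hB : TendstoInDistribution B atTop (fun z : ℝ => z) (fun _ => P) (gaussianReal 0 w))
    (hind : ∀ m, IndepFun (A m) (B m) P) :
    TendstoInDistribution (fun m ω => A m ω + B m ω) atTop (fun z : ℝ => z) (fun _ => P)
      (gaussianReal 0 (v + w)) where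
  forall_aemeasurable m := (hA.forall_aemeasurable m).add (hB.forall_aemeasurable m)
  aemeasurable_limit := by fun_prop
  tendsto := by
    refine ProbabilityMeasure.tendsto_iff_tendsto_charFun.2 fun t => ?_
    have h1 := ProbabilityMeasure.tendsto_iff_tendsto_charFun.1 hA.tendsto t
    have h2 := ProbabilityMeasure.tendsto_iff_tendsto_charFun.1 hB.tendsto t
    simp only [ProbabilityMeasure.coe_mk, Measure.map_id', charFun_gaussianReal] at h1 h2 ⊢
    convert! h1.mul h2 using 2 with m
    · rw [(hind m).charFun_map_fun_add_eq_mul (hA.forall_aemeasurable m)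
        (hB.forall_aemeasurable m), Pi.mul_apply]
    · rw [← Complex.exp_add]
      congr 1
      push_cast
      ring

/-- The central limit theorem for the mean of a bounded function of a sample of size `ν m`,
normalized by a sequence `N m` of the same order. -/
lemma tendstoInDistribution_sqrt_mul_mean {α : Type*} [MeasurableSpace α] [Countable α]
    [MeasurableSingletonClass α] {X : ℕ → Ω → α} {μ : PMF α} (hXm : ∀ i, Measurable (X i))
    (hXlaw : ∀ i, P.map (X i) = μ.toMeasure) (hX : iIndepFun X P) {g : α → ℝ}
    (hg : ∀ k, g k ∈ Set.Icc (0 : ℝ) 1) {ν : ℕ → ℕ} (hν : Tendsto ν atTop atTop) {N : ℕ → ℝ}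
    {ρ : ℝ} (hN : Tendsto (fun m => N m / ν m) atTop (𝓝 ρ)) (hN0 : ∀ m, 0 ≤ N m) (c : ℝ) :
    TendstoInDistribution (fun m ω => c * (√(N m) *
        ((ν m : ℝ)⁻¹ * ∑ i ∈ Finset.range (ν m), g (X i ω) - ∑' k, g k * (μ k).toReal)))
      atTop (fun z : ℝ => z) (fun _ => P)
      (gaussianReal 0 (ρ * c ^ 2 * Var[g; μ.toMeasure]).toNNReal) := by
  have hgm := measurable_of_countable g
  have hvar : Var[fun ω => g (X 0 ω); P] = Var[g; μ.toMeasure] := by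
    rw [← hXlaw 0, variance_map hgm.aemeasurable (hXm 0).aemeasurable]
    rfl
  have hclt := tendstoInDistribution_inv_sqrt_mul_sum_sub (P := P)
    (P' := gaussianReal 0 Var[fun ω => g (X 0 ω); P].toNNReal) (Y := fun z => z)
    (X := fun i ω => g (X i ω)) ⟨by fun_prop, Measure.map_id'⟩
    (memLp_comp_of_mem_Icc hXm hg 2 0) (hX.comp (fun _ => g) fun _ => hgm)
    (identDistrib_comp hXm hXlaw g)
  have hmeas (n : ℕ) : Measurable fun ω => ∑ i ∈ Finset.range n, g (X i ω) :=
    Finset.measurable_sum _ fun i _ => hgm.comp (hXm i)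
  have hclt' : TendstoInDistribution
      (fun m ω => (√(ν m : ℝ))⁻¹ * (∑ i ∈ Finset.range (ν m), g (X i ω)
        - (ν m : ℝ) * ∑' k, g k * (μ k).toReal)) atTop (fun z : ℝ => z) (fun _ => P)
      (gaussianReal 0 Var[fun ω => g (X 0 ω); P].toNNReal) := by
    rw [integral_comp_eq_tsum hXm hXlaw hg] at hclt
    exact ⟨fun m => hclt.forall_aemeasurable (ν m), hclt.aemeasurable_limit,
      hclt.tendsto.comp hν⟩
  have hρ : 0 ≤ ρ := ge_of_tendsto' hN fun m => div_nonneg (hN0 m) (Nat.cast_nonneg _)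
  refine tendstoInDistribution_gaussian_mul hclt' (F := fun m _ => c * √(N m / ν m))
    (c := c * √ρ) (fun m => measurable_const) (fun m => ?_) ?_ ?_ ?_
  · exact ((((hmeas (ν m)).const_mul _).sub_const _).const_mul _).const_mul _
  · exact ae_of_all _ fun ω => hN.sqrt.const_mul c
  · refine ae_of_all _ fun ω => ?_
    filter_upwards [hν.eventually_ge_atTop 1] with m hm
    have hν0 : (0 : ℝ) < ν m := by exact_mod_cast hm
    have hs := Real.sq_sqrt hν0.le
    have hs0 := (Real.sqrt_pos.2 hν0).ne'
    rw [Real.sqrt_div' _ hν0.le]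
    field_simp
    rw [hs]
    ring
  · rw [hvar, Real.coe_toNNReal _ (variance_nonneg _ _), Real.coe_toNNReal _ (mul_nonneg
      (mul_nonneg hρ (sq_nonneg c)) (variance_nonneg _ _)), mul_pow, Real.sq_sqrt hρ]
    ring

end

/-! ### The coincidence statistic: consistency and asymptotic normality -/

section
variable {d : ℕ}

lemma monomial_mem_Icc (pX pY : PMF (Fin d → ℕ)) (a b : ℕ) (k : Fin d → ℕ) :
    (pX k).toReal ^ a * (pY k).toReal ^ b ∈ Set.Icc (0 : ℝ) 1 := by
  have h1 := pow_mem_Icc (pmf_toReal_mem_Icc pX k) a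
  have h2 := pow_mem_Icc (pmf_toReal_mem_Icc pY k) b
  exact ⟨mul_nonneg h1.1 h2.1, mul_le_one₀ h1.2 h2.1 h2.2⟩

lemma variance_pmf_eq (μ : PMF (Fin d → ℕ)) {g : (Fin d → ℕ) → ℝ}
    (hg : ∀ k, g k ∈ Set.Icc (0 : ℝ) 1) :
    Var[g; μ.toMeasure] = ∑' k, g k ^ 2 * (μ k).toReal - (∑' k, g k * (μ k).toReal) ^ 2 := by
  have hmem : MemLp g 2 μ.toMeasure := MemLp.of_bound
    (measurable_of_countable g).aestronglyMeasurable 1 (ae_of_all _ fun k => by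
      rw [Real.norm_eq_abs, abs_of_nonneg (hg k).1]; exact (hg k).2)
  rw [variance_eq_sub hmem, integral_pmf_eq_tsum μ hg]
  congr 1
  exact integral_pmf_eq_tsum μ fun k => pow_mem_Icc (hg k) 2

lemma zeta10_eq (pX pY : PMF (Fin d → ℕ)) {a : ℕ} (ha : 1 ≤ a) (b : ℕ) :
    zeta10 pX pY a b = q pX pY (2 * a - 1) (2 * b) - q pX pY a b ^ 2 := by
  obtain ⟨a, rfl⟩ := Nat.exists_eq_add_of_le' ha
  rw [zeta10, variance_pmf_eq pX (monomial_mem_Icc pX pY _ _), q, q,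
    show 2 * (a + 1) - 1 = 2 * a + 1 by omega, Nat.add_sub_cancel]
  congr 2
  · funext k
    ring
  · congr 1
    funext k
    ring

lemma zeta01_eq (pX pY : PMF (Fin d → ℕ)) (a : ℕ) {b : ℕ} (hb : 1 ≤ b) :
    zeta01 pX pY a b = q pX pY (2 * a) (2 * b - 1) - q pX pY a b ^ 2 := by
  obtain ⟨b, rfl⟩ := Nat.exists_eq_add_of_le' hb
  rw [zeta01, variance_pmf_eq pY (monomial_mem_Icc pX pY _ _), q, q,
    show 2 * (b + 1) - 1 = 2 * b + 1 by omega, Nat.add_sub_cancel]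
  congr 2
  · funext k
    ring
  · congr 1
    funext k
    ring

lemma q_pos_of_zeta10_pos {pX pY : PMF (Fin d → ℕ)} {a b : ℕ} (ha : 1 ≤ a)
    (h : 0 < zeta10 pX pY a b) : 0 < q pX pY a b := by
  have hs := summable_monomial (pmf_toReal_mem_Icc pX) (pmf_toReal_mem_Icc pY)
    (hasSum_pmf_toReal pX).summable ha b
  have hnn : ∀ k, 0 ≤ (pX k).toReal ^ a * (pY k).toReal ^ b :=
    fun k => (monomial_mem_Icc pX pY a b k).1
  refine lt_of_le_of_ne (tsum_nonneg hnn) fun h0 => h.ne' ?_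
  -- if `q = 0`, all its terms vanish, hence so do all terms of `q_{2a-1,2b}`, and then `ζ_{1,0} = 0`
  have hz : ∀ k, (pX k).toReal ^ a * (pY k).toReal ^ b = 0 := by
    intro k
    have h' := hs.hasSum
    rw [show ∑' k, (pX k).toReal ^ a * (pY k).toReal ^ b = 0 from h0.symm] at h'
    exact congrFun ((hasSum_zero_iff_of_nonneg hnn).1 h') k
  have : q pX pY (2 * a - 1) (2 * b) = 0 := by
    rw [q, ← tsum_zero]
    refine tsum_congr fun k => ?_
    rw [show 2 * a - 1 = a + (a - 1) by omega, two_mul, pow_add, pow_add, mul_mul_mul_comm, hz k,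
      zero_mul]
  rw [zeta10_eq pX pY ha, this, ← h0]
  simp

variable {Ω : Type*} [MeasurableSpace Ω] {X Y : ℕ → Ω → (Fin d → ℕ)}

lemma measurable_Q (hXm : ∀ i, Measurable (X i)) (hYm : ∀ i, Measurable (Y i))
    (n₁ n₂ a b : ℕ) :
    Measurable fun ω => Q n₁ n₂ a b (fun i => X i ω) (fun i => Y i ω) := by
  unfold Q uStat psi psiAt
  have hE : Measurable (toEuclid (d := d)) := measurable_of_countable _
  refine Measurable.const_mul (Finset.measurable_sum _ fun S _ => Finset.measurable_sum _ fun T _ =>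
    Measurable.const_mul (Finset.measurable_sum _ fun i _ =>
      Measurable.ite ?_ measurable_const measurable_const) _) _
  have e : {ω | (∀ j ∈ S, dist (toEuclid (X i ω)) (toEuclid (X j ω)) ≤ 0)
      ∧ ∀ k ∈ T, dist (toEuclid (X i ω)) (toEuclid (Y k ω)) ≤ 0}
      = (⋂ j ∈ S, {ω | dist (toEuclid (X i ω)) (toEuclid (X j ω)) ≤ 0})
        ∩ ⋂ k ∈ T, {ω | dist (toEuclid (X i ω)) (toEuclid (Y k ω)) ≤ 0} := by
    ext ω; simp
  rw [e]
  refine (Finset.measurableSet_biInter _ fun j _ => ?_).inter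
    (Finset.measurableSet_biInter _ fun j _ => ?_)
  · exact measurableSet_le ((hE.comp (hXm i)).dist (hE.comp (hXm j))) measurable_const
  · exact measurableSet_le ((hE.comp (hXm i)).dist (hE.comp (hYm j))) measurable_const

variable {P : Measure Ω} [IsProbabilityMeasure P] {pX pY : PMF (Fin d → ℕ)} {n₁ n₂ : ℕ → ℕ}

/-- Strong consistency of the coincidence statistic. -/
lemma ae_tendsto_Q (hXm : ∀ i, Measurable (X i)) (hYm : ∀ i, Measurable (Y i))
    (hXlaw : ∀ i, P.map (X i) = pX.toMeasure) (hYlaw : ∀ i, P.map (Y i) = pY.toMeasure)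
    (hX : iIndepFun X P) (hY : iIndepFun Y P)
    (hn₁ : Tendsto n₁ atTop atTop) (hn₂ : Tendsto n₂ atTop atTop) {a : ℕ} (ha : 1 ≤ a) (b : ℕ) :
    ∀ᵐ ω ∂P, Tendsto (fun m => Q (n₁ m) (n₂ m) a b (fun i => X i ω) (fun i => Y i ω)) atTop
      (𝓝 (q pX pY a b)) := by
  filter_upwards [ae_tendsto_tsum_abs_empFreq_sub hXm hXlaw hX,
    ae_tendsto_tsum_abs_empFreq_sub hYm hYlaw hY] with ω h1 h2
  have hc₁ := tendsto_natCast_atTop_atTop (R := ℝ).comp hn₁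
  have hc₂ := tendsto_natCast_atTop_atTop (R := ℝ).comp hn₂
  have hbound := ((hc₁.const_div_atTop (2 * (a : ℝ) ^ 2)).add
    (hc₂.const_div_atTop (2 * (b : ℝ) ^ 2))).add
    (((h1.comp hn₁).const_mul (a : ℝ)).add ((h2.comp hn₂).const_mul (b : ℝ)))
  simp only [mul_zero, add_zero] at hbound
  rw [tendsto_iff_norm_sub_tendsto_zero]
  refine squeeze_zero' (Eventually.of_forall fun _ => norm_nonneg _) ?_ hbound
  filter_upwards [hn₁.eventually_ge_atTop (2 * a), hn₂.eventually_ge_atTop (2 * b)] with m hm₁ hm₂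
  have e1 := abs_Q_sub_plugin_le ha hm₁ hm₂ (fun i => X i ω) (fun i => Y i ω)
  have e2 := abs_tsum_monomial_sub_le (empFreq_mem_Icc (fun i => X i ω) (n₁ m))
    (pmf_toReal_mem_Icc pX) (empFreq_mem_Icc (fun i => Y i ω) (n₂ m)) (pmf_toReal_mem_Icc pY)
    (summable_empFreq _ _) (hasSum_pmf_toReal pX).summable (summable_empFreq _ _)
    (hasSum_pmf_toReal pY).summable ha b
  rw [Real.norm_eq_abs]
  exact (abs_sub_le _ _ _).trans (add_le_add e1 e2)

/-- The first-order (Hájek) part of `Q - q`: the weighted sum of the centred sample means of the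
two projections `p_X ^ (a - 1) * p_Y ^ b` and `p_X ^ a * p_Y ^ (b - 1)`. -/
noncomputable def linPart (pX pY : PMF (Fin d → ℕ)) (n₁ n₂ a b : ℕ) (x y : ℕ → Fin d → ℕ) : ℝ :=
  a * ((n₁ : ℝ)⁻¹ * ∑ i ∈ Finset.range n₁, (pX (x i)).toReal ^ (a - 1) * (pY (x i)).toReal ^ b
      - ∑' k, (pX k).toReal ^ (a - 1) * (pY k).toReal ^ b * (pX k).toReal)
    + b * ((n₂ : ℝ)⁻¹ * ∑ i ∈ Finset.range n₂, (pX (y i)).toReal ^ a * (pY (y i)).toReal ^ (b - 1)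
      - ∑' k, (pX k).toReal ^ a * (pY k).toReal ^ (b - 1) * (pY k).toReal)

lemma abs_Q_sub_sub_linPart_le (pX pY : PMF (Fin d → ℕ)) {n₁ n₂ a b : ℕ} (ha : 1 ≤ a)
    (h₁ : 2 * a ≤ n₁) (h₂ : 2 * b ≤ n₂) (x y : ℕ → Fin d → ℕ) :
    |Q n₁ n₂ a b x y - q pX pY a b - linPart pX pY n₁ n₂ a b x y|
      ≤ 2 * a ^ 2 / n₁ + 2 * b ^ 2 / n₂
        + (a + b : ℝ) ^ 2 * (∑' k, (empFreq x n₁ k - (pX k).toReal) ^ 2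
          + ∑' k, (empFreq y n₂ k - (pY k).toReal) ^ 2) := by
  have e1 := abs_Q_sub_plugin_le ha h₁ h₂ x y
  have e2 := abs_tsum_monomial_sub_taylor_le (empFreq_mem_Icc x n₁)
    (pmf_toReal_mem_Icc pX) (empFreq_mem_Icc y n₂) (pmf_toReal_mem_Icc pY)
    (summable_empFreq _ _) (hasSum_pmf_toReal pX).summable (summable_empFreq _ _)
    (hasSum_pmf_toReal pY).summable ha b
  rw [(hasSum_mul_empFreq (fun k => (pX k).toReal ^ (a - 1) * (pY k).toReal ^ b) x n₁).tsum_eq,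
    (hasSum_mul_empFreq (fun k => (pX k).toReal ^ a * (pY k).toReal ^ (b - 1)) y n₂).tsum_eq] at e2
  have e := (abs_add_le _ _).trans (add_le_add e1 e2)
  refine le_trans (le_of_eq ?_) e
  congr 1
  simp only [q, linPart]
  ring

lemma measurable_linPart (hXm : ∀ i, Measurable (X i)) (hYm : ∀ i, Measurable (Y i))
    (pX pY : PMF (Fin d → ℕ)) (n₁ n₂ a b : ℕ) :
    Measurable fun ω => linPart pX pY n₁ n₂ a b (fun i => X i ω) (fun i => Y i ω) := by
  have hmeas {Z : ℕ → Ω → (Fin d → ℕ)} (hZ : ∀ i, Measurable (Z i)) (n a b : ℕ) :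
      Measurable fun ω =>
        ∑ i ∈ Finset.range n, (pX (Z i ω)).toReal ^ a * (pY (Z i ω)).toReal ^ b :=
    Finset.measurable_sum _ fun i _ =>
      (measurable_of_countable fun k => (pX k).toReal ^ a * (pY k).toReal ^ b).comp (hZ i)
  exact ((((hmeas hXm _ _ _).const_mul _).sub_const _).const_mul _).add
    ((((hmeas hYm _ _ _).const_mul _).sub_const _).const_mul _)

lemma tendsto_sqrt_div {N : ℕ → ℝ} {ν : ℕ → ℕ} {ρ : ℝ} (hν : Tendsto ν atTop atTop)
    (hN : Tendsto (fun m => N m / ν m) atTop (𝓝 ρ)) :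
    Tendsto (fun m => √(N m) * (ν m : ℝ)⁻¹) atTop (𝓝 0) := by
  have h := hN.sqrt.mul (Real.tendsto_sqrt_atTop.comp
    (tendsto_natCast_atTop_atTop.comp hν)).inv_tendsto_atTop
  rw [mul_zero] at h
  refine h.congr fun m => ?_
  have hν0 : (0 : ℝ) ≤ ν m := Nat.cast_nonneg _
  rw [Real.sqrt_div' _ hν0, div_eq_mul_inv, mul_assoc]
  simp only [Pi.inv_apply, Function.comp_apply]
  rw [← mul_inv, Real.mul_self_sqrt hν0]

/-- The nonlinear part of `Q - q` is negligible at the scale `√n`: its first absolute moment is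
`O(1/n)`. -/
lemma tendstoInMeasure_remainder (hXm : ∀ i, Measurable (X i)) (hYm : ∀ i, Measurable (Y i))
    (hXlaw : ∀ i, P.map (X i) = pX.toMeasure) (hYlaw : ∀ i, P.map (Y i) = pY.toMeasure)
    (hX : iIndepFun X P) (hY : iIndepFun Y P)
    (hn₁ : Tendsto n₁ atTop atTop) (hn₂ : Tendsto n₂ atTop atTop) {a : ℕ} (ha : 1 ≤ a) (b : ℕ)
    {N : ℕ → ℝ} {ρ₁ ρ₂ : ℝ} (hN₁ : Tendsto (fun m => N m / n₁ m) atTop (𝓝 ρ₁))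
    (hN₂ : Tendsto (fun m => N m / n₂ m) atTop (𝓝 ρ₂)) :
    TendstoInMeasure P (fun m ω => √(N m) *
      (Q (n₁ m) (n₂ m) a b (fun i => X i ω) (fun i => Y i ω) - q pX pY a b
        - linPart pX pY (n₁ m) (n₂ m) a b (fun i => X i ω) (fun i => Y i ω))) atTop 0 := by
  refine tendstoInMeasure_of_tendsto_eLpNorm one_ne_zero (fun m => ?_)
    aestronglyMeasurable_const ?_
  · exact ((((measurable_Q hXm hYm _ _ _ _).sub_const _).sub
      (measurable_linPart hXm hYm _ _ _ _ _ _)).const_mul _).aestronglyMeasurable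
  have hs₁ := tendsto_sqrt_div hn₁ hN₁
  have hs₂ := tendsto_sqrt_div hn₂ hN₂
  set C : ℝ := (a + b : ℝ) ^ 2 with hC
  have hC0 : 0 ≤ C := sq_nonneg _
  have hlim : Tendsto (fun m => √(N m) * (2 * a ^ 2 / n₁ m + 2 * b ^ 2 / n₂ m)
      + (√(N m) * C * (n₁ m : ℝ)⁻¹ + √(N m) * C * (n₂ m : ℝ)⁻¹)) atTop (𝓝 0) := by
    have h := (hs₁.const_mul (2 * (a : ℝ) ^ 2 + C)).add (hs₂.const_mul (2 * (b : ℝ) ^ 2 + C))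
    rw [mul_zero, mul_zero, add_zero] at h
    refine h.congr fun m => ?_
    rw [div_eq_mul_inv, div_eq_mul_inv]
    ring
  have hlim' := ENNReal.tendsto_ofReal hlim
  rw [ENNReal.ofReal_zero] at hlim'
  refine tendsto_of_tendsto_of_tendsto_of_le_of_le' tendsto_const_nhds hlim'
    (Eventually.of_forall fun _ => zero_le) ?_
  filter_upwards [hn₁.eventually_ge_atTop (2 * a), hn₂.eventually_ge_atTop (2 * b),
    hn₁.eventually_ge_atTop 1, hn₂.eventually_ge_atTop 1] with m h₁ h₂ h₁' h₂'
  rw [eLpNorm_one_eq_lintegral_enorm, sub_zero]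
  have hK : 0 ≤ √(N m) * C := by positivity
  have hpt (ω : Ω) : ‖√(N m) *
      (Q (n₁ m) (n₂ m) a b (fun i => X i ω) (fun i => Y i ω) - q pX pY a b
        - linPart pX pY (n₁ m) (n₂ m) a b (fun i => X i ω) (fun i => Y i ω))‖ₑ
      ≤ ENNReal.ofReal (√(N m) * (2 * a ^ 2 / n₁ m + 2 * b ^ 2 / n₂ m))
        + (ENNReal.ofReal (√(N m) * C) * ENNReal.ofReal
            (∑' k, (empFreq (fun i => X i ω) (n₁ m) k - (pX k).toReal) ^ 2)
          + ENNReal.ofReal (√(N m) * C) * ENNReal.ofReal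
            (∑' k, (empFreq (fun i => Y i ω) (n₂ m) k - (pY k).toReal) ^ 2)) := by
    have ht1 : 0 ≤ ∑' k, (empFreq (fun i => X i ω) (n₁ m) k - (pX k).toReal) ^ 2 :=
      tsum_nonneg fun k => sq_nonneg _
    have ht2 : 0 ≤ ∑' k, (empFreq (fun i => Y i ω) (n₂ m) k - (pY k).toReal) ^ 2 :=
      tsum_nonneg fun k => sq_nonneg _
    rw [← ENNReal.ofReal_mul hK, ← ENNReal.ofReal_mul hK,
      ← ENNReal.ofReal_add (by positivity) (by positivity),
      ← ENNReal.ofReal_add (by positivity) (by positivity), Real.enorm_eq_ofReal_abs, abs_mul,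
      abs_of_nonneg (Real.sqrt_nonneg _)]
    refine ENNReal.ofReal_le_ofReal ?_
    have := mul_le_mul_of_nonneg_left (abs_Q_sub_sub_linPart_le pX pY ha h₁ h₂ (fun i => X i ω)
      (fun i => Y i ω)) (Real.sqrt_nonneg (N m))
    refine this.trans (le_of_eq ?_)
    rw [← hC]
    ring
  have hmX := measurable_ofReal_tsum_empFreq_sub_sq pX hXm (n₁ m)
  have hmY := measurable_ofReal_tsum_empFreq_sub_sq pY hYm (n₂ m)
  refine (lintegral_mono hpt).trans ?_
  rw [lintegral_add_left measurable_const, lintegral_add_left (hmX.const_mul _),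
    lintegral_const_mul _ hmX, lintegral_const_mul _ hmY, lintegral_const, measure_univ, mul_one,
    ENNReal.ofReal_add (by positivity) (by positivity),
    ENNReal.ofReal_add (by positivity) (by positivity), ENNReal.ofReal_mul hK,
    ENNReal.ofReal_mul hK]
  gcongr
  · exact lintegral_tsum_empFreq_sub_sq_le hXm hXlaw hX h₁'
  · exact lintegral_tsum_empFreq_sub_sq_le hYm hYlaw hY h₂'

end

section
variable {d : ℕ} {Ω : Type*} [MeasurableSpace Ω] {P : Measure Ω}
  {X Y : ℕ → Ω → (Fin d → ℕ)} {pX pY : PMF (Fin d → ℕ)} {n₁ n₂ : ℕ → ℕ}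

/-- Statistics of the first sample are independent of statistics of the second. -/
lemma indepFun_sum_sum (hXm : ∀ i, Measurable (X i)) (hYm : ∀ i, Measurable (Y i))
    (hindep : iIndepFun (Sum.elim X Y) P) (g h : (Fin d → ℕ) → ℝ) (n n' : ℕ) :
    IndepFun (fun ω => ∑ i ∈ Finset.range n, g (X i ω))
      (fun ω => ∑ i ∈ Finset.range n', h (Y i ω)) P := by
  let S : Finset (ℕ ⊕ ℕ) := (Finset.range n).map Function.Embedding.inl
  let T : Finset (ℕ ⊕ ℕ) := (Finset.range n').map Function.Embedding.inr
  have hST : Disjoint S T := Finset.disjoint_map_inl_map_inr _ _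
  have hm : ∀ i, Measurable (Sum.elim X Y i) := by
    rintro (i | i)
    · exact hXm i
    · exact hYm i
  have hsum (U : Finset (ℕ ⊕ ℕ)) (f : (Fin d → ℕ) → ℝ) :
      Measurable fun z : U → (Fin d → ℕ) => ∑ i, f (z i) :=
    Finset.measurable_sum _ fun i _ => (measurable_of_countable f).comp (measurable_pi_apply i)
  have hfin := (hindep.indepFun_finset S T hST hm).comp (hsum S g) (hsum T h)
  convert! hfin using 1
  · funext ω
    simp only [Function.comp_apply]
    rw [Finset.sum_coe_sort S fun i => g (Sum.elim X Y i ω), Finset.sum_map]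
    rfl
  · funext ω
    simp only [Function.comp_apply]
    rw [Finset.sum_coe_sort T fun i => h (Sum.elim X Y i ω), Finset.sum_map]
    rfl

variable [IsProbabilityMeasure P]

lemma tendsto_size_div_left {p : ℝ} (hp0 : 0 < p)
    (hprop : Tendsto (fun m => prop (n₁ m) (n₂ m)) atTop (𝓝 p)) :
    Tendsto (fun m => ((n₁ m : ℝ) + n₂ m) / n₁ m) atTop (𝓝 p⁻¹) := by
  refine (hprop.inv₀ hp0.ne').congr fun m => ?_
  rw [prop, inv_div]

lemma tendsto_size_div_right (hn₂ : Tendsto n₂ atTop atTop) {p : ℝ} (hp1 : p < 1)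
    (hprop : Tendsto (fun m => prop (n₁ m) (n₂ m)) atTop (𝓝 p)) :
    Tendsto (fun m => ((n₁ m : ℝ) + n₂ m) / n₂ m) atTop (𝓝 (1 - p)⁻¹) := by
  refine ((hprop.const_sub 1).inv₀ (sub_pos.2 hp1).ne').congr' ?_
  filter_upwards [hn₂.eventually_ge_atTop 1] with m hm
  have h2 : (1 : ℝ) ≤ n₂ m := by exact_mod_cast hm
  have h1 : (0 : ℝ) ≤ n₁ m := Nat.cast_nonneg _
  have h3 : (n₁ m : ℝ) + n₂ m ≠ 0 := by positivity
  rw [prop, one_sub_div h3, add_sub_cancel_left, inv_div]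

/-- Asymptotic normality of the coincidence statistic, possibly with a degenerate limit. -/
lemma tendstoInDistribution_sqrt_mul_Q_sub (hXm : ∀ i, Measurable (X i))
    (hYm : ∀ i, Measurable (Y i)) (hXlaw : ∀ i, P.map (X i) = pX.toMeasure)
    (hYlaw : ∀ i, P.map (Y i) = pY.toMeasure) (hindep : iIndepFun (Sum.elim X Y) P)
    {a : ℕ} (ha : 1 ≤ a) (b : ℕ) {p : ℝ} (hp0 : 0 < p) (hp1 : p < 1)
    (hn₁ : Tendsto n₁ atTop atTop) (hn₂ : Tendsto n₂ atTop atTop)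
    (hprop : Tendsto (fun m => prop (n₁ m) (n₂ m)) atTop (𝓝 p)) :
    TendstoInDistribution (fun m ω => √((n₁ m : ℝ) + n₂ m) *
        (Q (n₁ m) (n₂ m) a b (fun i => X i ω) (fun i => Y i ω) - q pX pY a b))
      atTop (fun z : ℝ => z) (fun _ => P) (gaussianReal 0 (kappa pX pY p a b).toNNReal) := by
  have hX : iIndepFun X P := iIndepFun.precomp (f := Sum.elim X Y) Sum.inl_injective hindep
  have hY : iIndepFun Y P := iIndepFun.precomp (f := Sum.elim X Y) Sum.inr_injective hindep
  have hN₁ := tendsto_size_div_left hp0 hprop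
  have hN₂ := tendsto_size_div_right hn₂ hp1 hprop
  have hN0 (m : ℕ) : (0 : ℝ) ≤ (n₁ m : ℝ) + n₂ m := by positivity
  have hA := tendstoInDistribution_sqrt_mul_mean hXm hXlaw hX
    (monomial_mem_Icc pX pY (a - 1) b) hn₁ hN₁ hN0 a
  have hB := tendstoInDistribution_sqrt_mul_mean hYm hYlaw hY
    (monomial_mem_Icc pX pY a (b - 1)) hn₂ hN₂ hN0 b
  have hAB := tendstoInDistribution_gaussian_add hA hB fun m =>
    (indepFun_sum_sum hXm hYm hindep (fun k => (pX k).toReal ^ (a - 1) * (pY k).toReal ^ b)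
      (fun k => (pX k).toReal ^ a * (pY k).toReal ^ (b - 1)) (n₁ m) (n₂ m)).comp
      (φ := fun z => (a : ℝ) * (√((n₁ m : ℝ) + n₂ m) * ((n₁ m : ℝ)⁻¹ * z
        - ∑' k, (pX k).toReal ^ (a - 1) * (pY k).toReal ^ b * (pX k).toReal)))
      (ψ := fun z => (b : ℝ) * (√((n₁ m : ℝ) + n₂ m) * ((n₂ m : ℝ)⁻¹ * z
        - ∑' k, (pX k).toReal ^ a * (pY k).toReal ^ (b - 1) * (pY k).toReal)))
      (by fun_prop) (by fun_prop)
  have hp1' : 0 < 1 - p := sub_pos.2 hp1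
  rw [← Real.toNNReal_add (mul_nonneg (by positivity) (variance_nonneg _ _))
    (mul_nonneg (by positivity) (variance_nonneg _ _))] at hAB
  refine tendstoInDistribution_of_tendstoInMeasure_sub _ _ hAB ?_ fun m =>
    (((measurable_Q hXm hYm _ _ _ _).sub_const _).const_mul _).aemeasurable
  convert! tendstoInMeasure_remainder hXm hYm hXlaw hYlaw hX hY hn₁ hn₂ ha b hN₁ hN₂ using 1
  funext m ω
  simp only [Pi.sub_apply, linPart]
  ring

/-! ### Studentization and the entropy estimator -/

lemma one_ne_of_zeta10_pos {a b : ℕ} (ha : 1 ≤ a) (h : 0 < zeta10 pX pY a b) :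
    (1 : ℝ) - (a + b) ≠ 0 := by
  intro hab
  have hab' : a + b = 1 := by
    have : ((a + b : ℕ) : ℝ) = 1 := by push_cast; linarith
    exact_mod_cast this
  obtain ⟨rfl, rfl⟩ : a = 1 ∧ b = 0 := by omega
  have hq : q pX pY 1 0 = 1 := by simpa [q] using (hasSum_pmf_toReal pX).tsum_eq
  rw [zeta10_eq pX pY le_rfl, hq] at h
  norm_num [hq] at h

lemma kappa_pos {a b : ℕ} (ha : 1 ≤ a) {p : ℝ} (hp0 : 0 < p) (hp1 : p < 1)
    (h : 0 < zeta10 pX pY a b) : 0 < kappa pX pY p a b := by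
  have hp1' : 0 < 1 - p := sub_pos.2 hp1
  have ha' : (0 : ℝ) < a := by exact_mod_cast ha
  exact add_pos_of_pos_of_nonneg (by positivity)
    (mul_nonneg (by positivity) (variance_nonneg _ _))

lemma tendsto_one_div_size (hn₁ : Tendsto n₁ atTop atTop) :
    Tendsto (fun m => 1 / ((n₁ m : ℝ) + n₂ m)) atTop (𝓝 0) := by
  refine Tendsto.const_div_atTop (tendsto_atTop_mono (fun m => ?_)
    (tendsto_natCast_atTop_atTop.comp hn₁)) 1
  simp

/-- Strong consistency of the variance estimator. -/
lemma ae_tendsto_kTrunc (hXm : ∀ i, Measurable (X i)) (hYm : ∀ i, Measurable (Y i))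
    (hXlaw : ∀ i, P.map (X i) = pX.toMeasure) (hYlaw : ∀ i, P.map (Y i) = pY.toMeasure)
    (hX : iIndepFun X P) (hY : iIndepFun Y P) {a : ℕ} (ha : 1 ≤ a) (b : ℕ) {p : ℝ} (hp0 : 0 < p)
    (hp1 : p < 1) (hn₁ : Tendsto n₁ atTop atTop) (hn₂ : Tendsto n₂ atTop atTop)
    (hprop : Tendsto (fun m => prop (n₁ m) (n₂ m)) atTop (𝓝 p)) :
    ∀ᵐ ω ∂P, Tendsto (fun m => kTrunc (n₁ m) (n₂ m) a b (fun i => X i ω) (fun i => Y i ω)) atTop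
      (𝓝 (kappa pX pY p a b)) := by
  have hcons {a' : ℕ} (ha' : 1 ≤ a') (b' : ℕ) :=
    ae_tendsto_Q hXm hYm hXlaw hYlaw hX hY hn₁ hn₂ ha' b'
  filter_upwards [hcons ha b, hcons (a' := 2 * a - 1) (by omega) (2 * b),
    hcons (a' := 2 * a) (by omega) (2 * b - 1)] with ω h h1 h2
  have hp1' : 0 < 1 - p := sub_pos.2 hp1
  have hκ0 : 0 ≤ kappa pX pY p a b :=
    add_nonneg (mul_nonneg (by positivity) (variance_nonneg _ _))
      (mul_nonneg (by positivity) (variance_nonneg _ _))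
  have hK := (((hprop.inv₀ hp0.ne').mul_const ((a : ℝ) ^ 2)).mul (h1.sub (h.pow 2))).add
    ((((hprop.const_sub 1).inv₀ hp1'.ne').mul_const ((b : ℝ) ^ 2)).mul (h2.sub (h.pow 2)))
  have hlim : p⁻¹ * (a : ℝ) ^ 2 * (q pX pY (2 * a - 1) (2 * b) - q pX pY a b ^ 2)
      + (1 - p)⁻¹ * (b : ℝ) ^ 2 * (q pX pY (2 * a) (2 * b - 1) - q pX pY a b ^ 2)
      = kappa pX pY p a b := by
    rw [kappa, zeta10_eq pX pY ha]
    rcases Nat.eq_zero_or_pos b with rfl | hb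
    · simp
    · rw [zeta01_eq pX pY a hb]
  rw [hlim] at hK
  have hmax := hK.max (tendsto_one_div_size (n₂ := n₂) hn₁)
  rwa [max_eq_left hκ0] at hmax

lemma measurable_kTrunc (hXm : ∀ i, Measurable (X i)) (hYm : ∀ i, Measurable (Y i))
    (n₁ n₂ a b : ℕ) :
    Measurable fun ω => kTrunc n₁ n₂ a b (fun i => X i ω) (fun i => Y i ω) := by
  have h (a b : ℕ) := measurable_Q hXm hYm n₁ n₂ a b
  unfold kTrunc K
  exact ((((h _ _).sub ((h _ _).pow_const 2)).const_mul _).add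
    (((h _ _).sub ((h _ _).pow_const 2)).const_mul _)).max measurable_const

lemma measurable_dslope_log (c : ℝ) : Measurable (dslope Real.log c) := by
  classical
  have e : dslope Real.log c
      = fun x => if x = c then deriv Real.log c else (x - c)⁻¹ * (Real.log x - Real.log c) := by
    funext x
    split_ifs with h
    · rw [h, dslope_same]
    · rw [dslope_of_ne _ h, slope_def_field, div_eq_inv_mul]
  rw [e]
  refine Measurable.ite (measurableSet_eq) measurable_const ?_
  exact ((measurable_id.sub_const _).inv).mul (Real.measurable_log.sub_const _)

end

end RenyiCoincidence

theorem theorem1 {Ω : Type*} [MeasurableSpace Ω] (P : Measure Ω) [IsProbabilityMeasure P]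
    {d : ℕ} (pX pY : PMF (Fin d → ℕ))
    (X Y : ℕ → Ω → (Fin d → ℕ))
    (hXm : ∀ i, Measurable (X i)) (hYm : ∀ i, Measurable (Y i))
    (hXlaw : ∀ i, P.map (X i) = pX.toMeasure) (hYlaw : ∀ i, P.map (Y i) = pY.toMeasure)
    (hindep : iIndepFun (Sum.elim X Y) P)
    (r₁ r₂ : ℕ) (hr₁ : 1 ≤ r₁)
    (p : ℝ) (hp0 : 0 < p) (hp1 : p < 1)
    (n₁ n₂ : ℕ → ℕ) (hn₁ : Tendsto n₁ atTop atTop) (hn₂ : Tendsto n₂ atTop atTop)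
    (hprop : Tendsto (fun m => RenyiCoincidence.prop (n₁ m) (n₂ m)) atTop (𝓝 p))
    (hζ10 : 0 < RenyiCoincidence.zeta10 pX pY r₁ r₂)
    (hζ01 : 1 ≤ r₂ → 0 < RenyiCoincidence.zeta01 pX pY r₁ r₂) :
    TendstoInDistribution
      (fun (m : ℕ) (ω : Ω) =>
        Real.sqrt ((n₁ m : ℝ) + (n₂ m : ℝ)) *
          (RenyiCoincidence.Q (n₁ m) (n₂ m) r₁ r₂ (fun i => X i ω) (fun i => Y i ω)
            - RenyiCoincidence.q pX pY r₁ r₂))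
      atTop (fun z : ℝ => z) (fun _ => P)
      (gaussianReal 0 (RenyiCoincidence.kappa pX pY p r₁ r₂).toNNReal)
    ∧ TendstoInDistribution
      (fun (m : ℕ) (ω : Ω) =>
        Real.sqrt ((n₁ m : ℝ) + (n₂ m : ℝ)) *
          (RenyiCoincidence.Q (n₁ m) (n₂ m) r₁ r₂ (fun i => X i ω) (fun i => Y i ω)
            - RenyiCoincidence.q pX pY r₁ r₂) /
          Real.sqrt
            (RenyiCoincidence.kTrunc (n₁ m) (n₂ m) r₁ r₂ (fun i => X i ω) (fun i => Y i ω)))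
      atTop (fun z : ℝ => z) (fun _ => P) (gaussianReal 0 1)
    ∧ TendstoInDistribution
      (fun (m : ℕ) (ω : Ω) =>
        Real.sqrt ((n₁ m : ℝ) + (n₂ m : ℝ)) * (1 - ((r₁ : ℝ) + (r₂ : ℝ))) *
          (RenyiCoincidence.Q (n₁ m) (n₂ m) r₁ r₂ (fun i => X i ω) (fun i => Y i ω) /
            Real.sqrt
              (RenyiCoincidence.kTrunc (n₁ m) (n₂ m) r₁ r₂ (fun i => X i ω) (fun i => Y i ω))) *
          (RenyiCoincidence.H (n₁ m) (n₂ m) r₁ r₂ (fun i => X i ω) (fun i => Y i ω)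
            - RenyiCoincidence.h pX pY r₁ r₂))
      atTop (fun z : ℝ => z) (fun _ => P) (gaussianReal 0 1) := by
  open RenyiCoincidence in
  have hX : iIndepFun X P := iIndepFun.precomp (f := Sum.elim X Y) Sum.inl_injective hindep
  have hY : iIndepFun Y P := iIndepFun.precomp (f := Sum.elim X Y) Sum.inr_injective hindep
  have hq : 0 < q pX pY r₁ r₂ := q_pos_of_zeta10_pos hr₁ hζ10
  have hκ : 0 < kappa pX pY p r₁ r₂ := kappa_pos hr₁ hp0 hp1 hζ10
  have hr : (1 : ℝ) - (r₁ + r₂) ≠ 0 := one_ne_of_zeta10_pos hr₁ hζ10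
  have hclt := tendstoInDistribution_sqrt_mul_Q_sub hXm hYm hXlaw hYlaw hindep hr₁ r₂ hp0 hp1
    hn₁ hn₂ hprop
  have hQm (m : ℕ) := measurable_Q hXm hYm (n₁ m) (n₂ m) r₁ r₂
  have hkm (m : ℕ) := (measurable_kTrunc hXm hYm (n₁ m) (n₂ m) r₁ r₂).sqrt
  have hQ := ae_tendsto_Q hXm hYm hXlaw hYlaw hX hY hn₁ hn₂ hr₁ r₂
  have hk := ae_tendsto_kTrunc hXm hYm hXlaw hYlaw hX hY hr₁ r₂ hp0 hp1 hn₁ hn₂ hprop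
  have hsκ : √(kappa pX pY p r₁ r₂) ≠ 0 := (Real.sqrt_pos.2 hκ).ne'
  have hw : ((1 : NNReal) : ℝ) = (√(kappa pX pY p r₁ r₂))⁻¹ ^ 2
      * ((kappa pX pY p r₁ r₂).toNNReal : ℝ) := by
    rw [Real.coe_toNNReal _ hκ.le, inv_pow, Real.sq_sqrt hκ.le, inv_mul_cancel₀ hκ.ne',
      NNReal.coe_one]
  refine ⟨hclt, ?_, ?_⟩
  · refine tendstoInDistribution_gaussian_mul hclt (F := fun m ω =>
      (√(kTrunc (n₁ m) (n₂ m) r₁ r₂ (fun i => X i ω) (fun i => Y i ω)))⁻¹)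
      (c := (√(kappa pX pY p r₁ r₂))⁻¹) (fun m => (hkm m).inv)
      (fun m => (((hQm m).sub_const _).const_mul _).div (hkm m)) ?_
      (ae_of_all _ fun ω => Eventually.of_forall fun m => div_eq_mul_inv _ _) hw
    filter_upwards [hk] with ω hω
    exact hω.sqrt.inv₀ hsκ
  · -- the delta method: `log Q - log q = (Q - q) * dslope log q Q`, and the slope tends to `1 / q`
    refine tendstoInDistribution_gaussian_mul hclt (F := fun m ω =>
      Q (n₁ m) (n₂ m) r₁ r₂ (fun i => X i ω) (fun i => Y i ω)
        / √(kTrunc (n₁ m) (n₂ m) r₁ r₂ (fun i => X i ω) (fun i => Y i ω))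
        * dslope Real.log (q pX pY r₁ r₂)
          (Q (n₁ m) (n₂ m) r₁ r₂ (fun i => X i ω) (fun i => Y i ω)))
      (c := (√(kappa pX pY p r₁ r₂))⁻¹)
      (fun m => ((hQm m).div (hkm m)).mul ((measurable_dslope_log _).comp (hQm m)))
      (fun m => ?_) ?_ ?_ hw
    · exact (((hQm m).div (hkm m)).const_mul _).mul
        ((((hQm m).max measurable_const).log.div_const _).sub_const _)
    · filter_upwards [hQ, hk] with ω hQω hkω
      have hd : ContinuousAt (dslope Real.log (q pX pY r₁ r₂)) (q pX pY r₁ r₂) :=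
        continuousAt_dslope_same.2 (Real.differentiableAt_log hq.ne')
      have hlim := (hQω.div hkω.sqrt hsκ).mul (hd.tendsto.comp hQω)
      rw [dslope_same, Real.deriv_log, div_mul_eq_mul_div, mul_inv_cancel₀ hq.ne', one_div] at hlim
      exact hlim
    · filter_upwards [hQ] with ω hQω
      -- the truncation at `1/n` is eventually inactive because `Q → q > 0`
      filter_upwards [(tendsto_one_div_size (n₂ := n₂) hn₁).eventually_lt hQω hq] with m hm
      have hs := sub_smul_dslope Real.log (q pX pY r₁ r₂)
        (Q (n₁ m) (n₂ m) r₁ r₂ (fun i => X i ω) (fun i => Y i ω))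
      rw [smul_eq_mul] at hs
      rw [H, RenyiCoincidence.h, max_eq_left hm.le, ← sub_div, ← hs]
      field_simp
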